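/- **Setting.** Let $K\ge 2$, $t\ge 1$, $\mathcal W=[0,1]^d$. In rounds $\tau=1,\dots,t$ a learner observes a context $W_\tau\in\mathcal W$, takes an action $A_\tau\in[K]$ and receives a reward $Y_\tau\in\{0,1\}$; put $O_\tau=(W_\tau,A_\tau,Y_\tau)$ and $F_\tau=\sigma(O_1,\dots,O_\tau)$. A policy is a map $g:[K]\times\mathcal W\to\mathbb R_+$ with $\sum_{a}g(a,w)=1$ for all $w$. The designs $g_1,\dots,g_t$ are random policies, with $g_\tau$ being $F_{\tau-1}$-measurable (jointly in its argument). In each round, $W_\tau$ has law $Q$ and is independent of $F_{\tau-1}$; $P[A_\tau=a\mid F_{\tau-1},W_\tau]=g_\tau(a,W_\tau)$; and the conditional law of $Y_\tau$ given $F_{\tau-1},W_\tau,A_\tau$ is $\kappa(A_\tau,W_\tau)$, where the kernel $\kappa$ does not depend on $\tau$. Let $(W^{\mathrm{ref}},A^{\mathrm{ref}},Y^{\mathrm{ref}})$ be such that $W^{\mathrm{ref}}\sim Q$, $A^{\mathrm{ref}}$ is uniform on $[K]$ and independent of $W^{\mathrm{ref}}$, and $Y^{\mathrm{ref}}\mid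 A^{\mathrm{ref}},W^{\mathrm{ref}}\sim\kappa(A^{\mathrm{ref}},W^{\mathrm{ref}})$. Let $\mathcal F_0$ be a class of measurable functions $\mathcal W\to\mathbb R$, and let $(\phi,\mathcal F)$ be one of the following two pairs: * $\phi(x)=x$, and $\mathcal F$ is the class of all $f:[K]\times\mathcal W\to\mathbb R$ such that $f(a,\cdot)\in\mathcal F_0$ for all $a$ and $(f(a,w))_{a\in[K]}$ lies in the probability simplex for all $w$; * $\phi(x)=\max(0,1+x)$, and $\mathcal F$ is the class of all $f:[K]\times\mathcal W\to\mathbb R$ such that $f(a,\cdot)\in\mathcal F_0$ for all $a$ and $\sum_{a}f(a,w)=0$ for all $w$. Define the $\phi$-risk and its importance-sampling weighted empirical counterpart by $$R^\phi(f)=E\big[\phi(f(A^{\mathrm{ref}},W^{\mathrm{ref}}))(1-Y^{\mathrm{ref}})\big],\qquad \widehat R_t(f)=\frac1t\sum_{\tau=1}^t\frac{1/K}{g_\tau(A_\tau,W_\tau)}\,\phi(f(A_\tau,W_\tau))(1-Y_\tau).$$ For $\epsilon>0$ let $N_{[\,]}(\epsilon,\mathcal F,L_2(P))\in\mathbb N\cup\{\infty\}$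 be the smallest number of brackets $[l,u]$ ($l,u$ measurable functions on $[K]\times\mathcal W$) with $\|u-l\|_{L_2(P)}\le\epsilon$ such that every $f\in\mathcal F$ satisfies $l\le f\le u$ everywhere for one of them; here the $L_2(P)$ norm is that of the law of $(A^{\mathrm{ref}},W^{\mathrm{ref}})$. Put $$H_t(\alpha,\delta,v,B)=\alpha+160\sqrt{\frac vt}\int_{\alpha/2}^{B}\sqrt{\log\big(1+N_{[\,]}(\epsilon,\mathcal F,L_2(P))\big)}\,d\epsilon+\frac{3B}{\delta t}\log 2\ \in(0,\infty].$$ **Theorem.** Suppose that there are $B,\delta>0$ such that $$\sup_{f_1,f_2\in\mathcal F}\ \sup_{a\in[K],\,w\in\mathcal W}|\phi(f_1(a,w))-\phi(f_2(a,w))|\le B,\qquad \min_{\tau\in[t]}\min_{a\in[K]}g_\tau(a,W_\tau)\ge\delta\ \text{ a.s.}$$ Let $f^*_{\mathcal F}$ be a minimizer of $R^\phi$ over $\mathcal F$ and let $\widehat f_t$ be a (data-dependent) minimizer of $\widehat R_t$ over $\mathcal F$. Then, for all $x>0$ and $\alpha\in(0,B)$, $$P\left[R^\phi(\widehat f_t)-R^\phi(f^*_{\mathcal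 F})\ \ge\ H_t\!\left(\alpha,\delta,\frac K\delta,B\right)+160B\sqrt{\frac{Kx}{\delta t}}+\frac{3Bx}{\delta t}\right]\le 2e^{-x}.$$ -/

import Mathlib

open MeasureTheory ProbabilityTheory
open scoped ENNReal

noncomputable section

namespace EpsGreedy

/-! ### Bracketing numbers -/

/-- The finite set `S` of pairs `(l, u)` is an `ε`-bracketing of `F` in `L_r(P)`: each pair is a
pair of measurable functions with `‖u - l‖_{P,r} ≤ ε`, and each `f ∈ F` lies, pointwise everywhere,
in one of the brackets `[l, u]`. -/
def IsBracketing {X : Type*} [MeasurableSpace X] (ε : ℝ) (F : Set (X → ℝ)) (r : ℝ≥0∞)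
    (P : Measure X) (S : Finset ((X → ℝ) × (X → ℝ))) : Prop :=
  (∀ b ∈ S, Measurable b.1 ∧ Measurable b.2 ∧ eLpNorm (b.2 - b.1) r P ≤ ENNReal.ofReal ε) ∧
    ∀ f ∈ F, ∃ b ∈ S, ∀ x, b.1 x ≤ f x ∧ f x ≤ b.2 x

/-- The bracketing number `N_[](ε, F, L_r(P))`: the least cardinality of an `ε`-bracketing,
and `⊤` if there is no finite one. -/
def bracketingNumber {X : Type*} [MeasurableSpace X] (ε : ℝ) (F : Set (X → ℝ)) (r : ℝ≥0∞)
    (P : Measure X) : ℕ∞ :=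
  ⨅ (S : Finset ((X → ℝ) × (X → ℝ))) (_ : IsBracketing ε F r P S), (S.card : ℕ∞)

/-- `√(log (1 + N))`, with value `∞` at `N = ∞`. -/
def sqrtLogOneAdd (N : ℕ∞) : ℝ≥0∞ :=
  if N = ⊤ then ⊤ else ENNReal.ofReal (Real.sqrt (Real.log (1 + (N.toNat : ℝ))))

/-- `H_t(α, δ, v, B) = α + 160 √(v/t) ∫_{α/2}^B √(log (1 + N ε)) dε + (3B/(δt)) log 2`
as an extended nonnegative real number, `N` being the bracketing number as a function of `ε`.
It is `∞` if the entropy integral diverges. -/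
def entropyBound (N : ℝ → ℕ∞) (t : ℕ) (α δ v B : ℝ) : ℝ≥0∞ :=
  ENNReal.ofReal α
    + ENNReal.ofReal (160 * Real.sqrt (v / t))
        * (∫⁻ ε in Set.Icc (α / 2) B, sqrtLogOneAdd (N ε))
    + ENNReal.ofReal (3 * B / (δ * t) * Real.log 2)

/-! ### Contexts, policies, regressors -/

/-- The context space `[0,1]^d`. -/
abbrev Ctx (d : ℕ) : Type := Fin d → unitInterval

/-- A policy: a nonnegative function of (action, context) that sums to one over the actions. -/
def IsPolicy {K d : ℕ} (f : Fin K × Ctx d → ℝ) : Prop :=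
  (∀ a w, 0 ≤ f (a, w)) ∧ ∀ w, ∑ a, f (a, w) = 1

/-- The reference policy: uniform over the actions. -/
def gRef {K d : ℕ} : Fin K × Ctx d → ℝ := fun _ => (K : ℝ)⁻¹

/-- The class `F^Id` derived from `F₀`: the coordinates are in `F₀`, the values in the simplex. -/
def classId {K d : ℕ} (F₀ : Set (Ctx d → ℝ)) : Set (Fin K × Ctx d → ℝ) :=
  {f | (∀ a, (fun w => f (a, w)) ∈ F₀) ∧ ∀ w, (fun a => f (a, w)) ∈ stdSimplex ℝ (Fin K)}

/-- The class `F^hinge` derived from `F₀`: the coordinates are in `F₀` and sum to zero. -/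
def classHinge {K d : ℕ} (F₀ : Set (Ctx d → ℝ)) : Set (Fin K × Ctx d → ℝ) :=
  {f | (∀ a, (fun w => f (a, w)) ∈ F₀) ∧ ∀ w, ∑ a, f (a, w) = 0}

/-- The identity mapping. -/
def phiId : ℝ → ℝ := fun x => x

/-- The hinge mapping. -/
def phiHinge : ℝ → ℝ := fun x => max 0 (1 + x)

/-! ### Losses and risks. Rewards are in `Fin 2 = {0, 1}`. -/

/-- `ℓ^φ(f)(w, a, y) = φ(f(a, w)) (1 - y)`. -/
def loss {K d : ℕ} (φ : ℝ → ℝ) (f : Fin K × Ctx d → ℝ) (w : Ctx d) (a : Fin K) (y : Fin 2) : ℝ :=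
  φ (f (a, w)) * (1 - ((y : ℕ) : ℝ))

/-- The importance-sampling weighted loss, for data collected under the design `g`:
`(g_ref(a, w) / g(a, w)) φ(f(a, w)) (1 - y)`. -/
def isLoss {K d : ℕ} (φ : ℝ → ℝ) (g f : Fin K × Ctx d → ℝ) (w : Ctx d) (a : Fin K) (y : Fin 2) :
    ℝ :=
  gRef (a, w) / g (a, w) * loss φ f w a y

/-- The law of `(A^ref, W^ref)`: the action is uniform and independent of the context, which has
law `Q`. -/
def refDesignLaw {K d : ℕ} (Q : Measure (Ctx d)) : Measure (Fin K × Ctx d) :=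
  (uniformOn (Set.univ : Set (Fin K))).prod Q

/-- The law of `((A^ref, W^ref), Y^ref)`: given `(A^ref, W^ref) = (a, w)`, the reward has law
`κ (a, w)`. -/
def refLaw {K d : ℕ} (Q : Measure (Ctx d)) (κ : Kernel (Fin K × Ctx d) (Fin 2)) :
    Measure ((Fin K × Ctx d) × Fin 2) :=
  (refDesignLaw Q) ⊗ₘ κ

/-- The `φ`-risk `R^φ(f) = E[ℓ^φ(f)(O^ref)]`. -/
def risk {K d : ℕ} (Q : Measure (Ctx d)) (κ : Kernel (Fin K × Ctx d) (Fin 2)) (φ : ℝ → ℝ)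
    (f : Fin K × Ctx d → ℝ) : ℝ :=
  ∫ o, loss φ f o.1.2 o.1.1 o.2 ∂(refLaw Q κ)

/-- The empirical `φ`-risk `t⁻¹ ∑_{τ=1}^t ℓ^φ_τ(f)(w_τ, a_τ, y_τ)` of data
`(w_τ, a_τ, y_τ)` collected under the designs `g_τ`. -/
def empiricalRisk {K d : ℕ} (t : ℕ) (φ : ℝ → ℝ) (g : ℕ → Fin K × Ctx d → ℝ) (w : ℕ → Ctx d)
    (a : ℕ → Fin K) (y : ℕ → Fin 2) (f : Fin K × Ctx d → ℝ) : ℝ :=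
  (t : ℝ)⁻¹ * ∑ τ ∈ Finset.Icc 1 t, isLoss φ (g τ) f (w τ) (a τ) (y τ)

/-! ### The bandit process -/

/-- `F_n`: the σ-algebra generated by `O_1, …, O_n`, where `O_s = (W_s, A_s, Y_s)`. -/
abbrev history {Ω : Type*} {K d : ℕ} (W : ℕ → Ω → Ctx d) (A : ℕ → Ω → Fin K) (Y : ℕ → Ω → Fin 2)
    (n : ℕ) : MeasurableSpace Ω :=
  ⨆ s ∈ Set.Icc 1 n, MeasurableSpace.comap (fun ω => (W s ω, A s ω, Y s ω)) inferInstance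

/-- The random function `g` of (action, context) is measurable with respect to the
σ-algebra `m` on `Ω`, jointly with its argument. -/
def IsMeasurableDesign {Ω : Type*} {K d : ℕ} (m : MeasurableSpace Ω)
    (g : Ω → Fin K × Ctx d → ℝ) : Prop :=
  Measurable[m.prod (inferInstance : MeasurableSpace (Fin K × Ctx d))] (Function.uncurry g)

/-- The first `t` rounds of a contextual bandit with context law `Q`, reward law `κ` given
(action, context), and designs `g_1, …, g_t`: in round `τ` the context is drawn from `Q`
independently of the past, then the action from `g_τ(·, W_τ)`, then the reward from
`κ (A_τ, W_τ)`. -/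
structure IsContextualBandit {Ω : Type*} [MeasurableSpace Ω] {K d : ℕ} (μ : Measure Ω)
    (Q : Measure (Ctx d)) (κ : Kernel (Fin K × Ctx d) (Fin 2)) (t : ℕ)
    (g : ℕ → Ω → Fin K × Ctx d → ℝ)
    (W : ℕ → Ω → Ctx d) (A : ℕ → Ω → Fin K) (Y : ℕ → Ω → Fin 2) : Prop where
  measurable_context : ∀ τ ∈ Finset.Icc 1 t, Measurable (W τ)
  measurable_action : ∀ τ ∈ Finset.Icc 1 t, Measurable (A τ)
  measurable_reward : ∀ τ ∈ Finset.Icc 1 t, Measurable (Y τ)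
  context_law : ∀ τ ∈ Finset.Icc 1 t, μ.map (W τ) = Q
  context_indep : ∀ τ ∈ Finset.Icc 1 t,
    Indep (MeasurableSpace.comap (W τ) inferInstance) (history W A Y (τ - 1)) μ
  action_law : ∀ τ ∈ Finset.Icc 1 t, ∀ a : Fin K,
    μ[fun ω => if A τ ω = a then (1 : ℝ) else 0 |
        history W A Y (τ - 1) ⊔ MeasurableSpace.comap (W τ) inferInstance]
      =ᵐ[μ] fun ω => g τ ω (a, W τ ω)
  reward_law : ∀ τ ∈ Finset.Icc 1 t, ∀ y : Fin 2,
    μ[fun ω => if Y τ ω = y then (1 : ℝ) else 0 |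
        history W A Y (τ - 1) ⊔
          MeasurableSpace.comap (fun ω => (A τ ω, W τ ω)) inferInstance]
      =ᵐ[μ] fun ω => (κ (A τ ω, W τ ω)).real {y}

end EpsGreedy

end

namespace EpsGreedy

/-! Write `X_τ(q)` for the importance-weighted value of `q` times `1 - Y_τ`, `R(q)` for the risk
under the reference law, and `D(q) = ∑_τ (R(q) - X_τ(q))`. Since `fhat` minimizes the empirical
risk, `t (R(φ ∘ fhat) - R(φ ∘ f*)) ≤ D(φ ∘ fhat - φ ∘ f*)` whenever these risks are integrable. It
thus suffices to bound `D(h - h₀)` from above, uniformly over `h` in `φ ∘ F`, with `h₀ = φ ∘ f*`.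

The decisive point is one-sidedness. Importance weighting makes `X_τ(q)` conditionally unbiased
given the past, and `g ≥ δ` bounds its conditional second moment by `‖q‖² / (Kδ)`. If `q ≥ 0` then
`-X_τ(q)` is bounded above by zero, so `e^y ≤ 1 + y + y²` for `y ≤ 1` yields a purely sub-Gaussian
tail for `D(q)`, whatever the sup norm of `q` (`IsContextualBandit.measure_lower_deviation_le`).

The chaining is therefore done with nonnegative links only. Start from `c = h₀ - B`, which lies
below every `h`, and take running maxima of `c` and the lower brackets of `h` at scales `ε₀, ε₀/2,
…, α`. Each increment is nonnegative, with `L²` norm at most the previous bracket width. What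
remains above the last maximum is nonnegative with risk at most `α`, so it costs at most `tα`. The
constant `-B` left over by the starting point is a single function; its Bernstein bound
(`IsContextualBandit.measure_upper_deviation_le`) provides the linear term in `x`. No truncation of
the links is needed (`IsContextualBandit.exists_deviation_bound`).

The union bound at level `n` runs over at most `∏_{k ≤ n} N_k` increments, at the price `x + ∑_{k ≤
n} log (2 N_k)`. Summation by parts and a comparison of dyadic sums with an integral turn these
prices into the entropy integral (`chaining_sum_le`, `sum_dyadic_le_lintegral`). Chain and constant
each fail with probability at most `e^{-x}`. Finally `φ` is monotone and 1-Lipschitz, so brackets of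
`F` give brackets of `φ ∘ F` that are no wider. -/

/-! ### Integrating out one round: reward, action, context -/

/-- The measures with densities `f` and `h` agree on `m`, hence give the same integral to every
nonnegative `m`-measurable function. Working with `∫⁻` removes any integrability condition on `H`.
-/
theorem lintegral_mul_ofReal_eq_of_condExp_ae_eq {Ω : Type*} {m mΩ : MeasurableSpace Ω}
    (hm : m ≤ mΩ) {μ : Measure Ω} [IsFiniteMeasure μ] {f h : Ω → ℝ} (hf : Integrable f μ)
    (hf0 : 0 ≤ f) (hfh : μ[f|m] =ᵐ[μ] h) {H : Ω → ℝ≥0∞} (hH : Measurable[m] H) :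
    ∫⁻ ω, H ω * ENNReal.ofReal (f ω) ∂μ = ∫⁻ ω, H ω * ENNReal.ofReal (h ω) ∂μ := by
  have hh : Integrable h μ := (integrable_condExp (m := m) (f := f) (μ := μ)).congr hfh
  have hh0 : 0 ≤ᵐ[μ] h :=
    (condExp_nonneg (m := m) (Filter.Eventually.of_forall hf0)).trans_eq hfh
  have key : (μ.withDensity fun ω => ENNReal.ofReal (f ω)).trim hm =
      (μ.withDensity fun ω => ENNReal.ofReal (h ω)).trim hm := by
    refine @Measure.ext _ m _ _ fun s hs => ?_
    rw [trim_measurableSet_eq hm hs, trim_measurableSet_eq hm hs,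
      withDensity_apply _ (hm s hs), withDensity_apply _ (hm s hs),
      ← ofReal_integral_eq_lintegral_ofReal hf.integrableOn
        (Filter.Eventually.of_forall hf0),
      ← ofReal_integral_eq_lintegral_ofReal hh.integrableOn (ae_restrict_of_ae hh0),
      ← setIntegral_condExp hm hf hs]
    congr 1
    exact setIntegral_congr_ae (hm s hs) (hfh.mono fun ω hω _ => hω)
  have hHm : Measurable H := hH.mono hm le_rfl
  have e (k : Ω → ℝ) (hk : Integrable k μ) : ∫⁻ ω, H ω * ENNReal.ofReal (k ω) ∂μ =
      ∫⁻ ω, H ω ∂((μ.withDensity fun ω => ENNReal.ofReal (k ω)).trim hm) := by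
    rw [lintegral_trim hm hH, lintegral_withDensity_eq_lintegral_mul₀
      hk.1.aemeasurable.ennreal_ofReal hHm.aemeasurable]
    simp only [Pi.mul_apply, mul_comm]
  rw [e f hf, e h hh, key]

theorem lintegral_mul_ite_eq_of_condExp {Ω β : Type*} {m mΩ : MeasurableSpace Ω} (hm : m ≤ mΩ)
    {μ : Measure Ω} [IsFiniteMeasure μ] [MeasurableSpace β] [MeasurableSingletonClass β]
    [DecidableEq β] {X : Ω → β} (hX : Measurable X) (b : β) {h : Ω → ℝ}
    (hXh : μ[fun ω => if X ω = b then (1 : ℝ) else 0 | m] =ᵐ[μ] h)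
    {H : Ω → ℝ≥0∞} (hH : Measurable[m] H) :
    ∫⁻ ω, H ω * ENNReal.ofReal (if X ω = b then 1 else 0) ∂μ =
      ∫⁻ ω, H ω * ENNReal.ofReal (h ω) ∂μ := by
  refine lintegral_mul_ofReal_eq_of_condExp_ae_eq hm ?_ (fun ω => ?_) hXh hH
  · exact (integrable_const (1 : ℝ)).mono'
      (Measurable.ite (hX (measurableSet_singleton b)) measurable_const
        measurable_const).aestronglyMeasurable
      (Filter.Eventually.of_forall fun ω => by split_ifs <;> simp)
  · dsimp only [Pi.zero_apply]
    split_ifs <;> simp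

theorem lintegral_of_indepFun {Ω T E : Type*} [MeasurableSpace Ω] [MeasurableSpace T]
    [MeasurableSpace E] {μ : Measure Ω} [IsProbabilityMeasure μ] {X : Ω → T} {W : Ω → E}
    (hX : Measurable X) (hW : Measurable W) (hind : IndepFun X W μ)
    {Ψ : T × E → ℝ≥0∞} (hΨ : Measurable Ψ) :
    ∫⁻ ω, Ψ (X ω, W ω) ∂μ = ∫⁻ ω, ∫⁻ w, Ψ (X ω, w) ∂(μ.map W) ∂μ := by
  have := Measure.isProbabilityMeasure_map (μ := μ) hW.aemeasurable
  rw [indepFun_iff_map_prod_eq_prod_map_map hX.aemeasurable hW.aemeasurable] at hind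
  rw [← lintegral_map hΨ (hX.prodMk hW), hind, lintegral_prod _ hΨ.aemeasurable,
    lintegral_map hΨ.lintegral_prod_right' hX]

/-- Independence from a σ-algebra `m` is independence from the identity map into `(Ω, m)`, so Fubini
for independent variables applies. -/
theorem lintegral_of_indep {Ω E : Type*} {m mΩ : MeasurableSpace Ω} [MeasurableSpace E]
    (hm : m ≤ mΩ) {μ : Measure Ω} [IsProbabilityMeasure μ] {W : Ω → E} (hW : Measurable W)
    (hind : Indep (MeasurableSpace.comap W inferInstance) m μ)
    {Ψ : Ω × E → ℝ≥0∞} (hΨ : Measurable[m.prod inferInstance] Ψ) :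
    ∫⁻ ω, Ψ (ω, W ω) ∂μ = ∫⁻ ω, ∫⁻ w, Ψ (ω, w) ∂(μ.map W) ∂μ := by
  refine @lintegral_of_indepFun Ω Ω E mΩ m _ μ _ id W (measurable_id.mono hm le_rfl) hW ?_ Ψ hΨ
  refine (@IndepFun_iff_Indep Ω Ω E mΩ m _ id W μ).2 ?_
  rw [MeasurableSpace.comap_id]
  exact hind.symm

theorem lintegral_refDesignLaw {K d : ℕ} [NeZero K] (Q : Measure (Ctx d)) [IsProbabilityMeasure Q]
    {h : Fin K × Ctx d → ℝ≥0∞} (hh : Measurable h) :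
    ∫⁻ p, h p ∂(refDesignLaw Q) = (K : ℝ≥0∞)⁻¹ * ∫⁻ w, ∑ a, h (a, w) ∂Q := by
  have hs (a : Fin K) : uniformOn (Set.univ : Set (Fin K)) {a} = (K : ℝ≥0∞)⁻¹ := by
    rw [uniformOn_univ]; simp
  rw [refDesignLaw, lintegral_prod _ hh.aemeasurable, lintegral_fintype]
  simp only [hs]
  rw [← Finset.sum_mul, mul_comm, lintegral_finsetSum]
  fun_prop

theorem measurable_comp_graph {Ω E β : Type*} {m : MeasurableSpace Ω} [MeasurableSpace E]
    [MeasurableSpace β] {Ψ : Ω × E → β} (hΨ : Measurable[m.prod inferInstance] Ψ) (V : Ω → E) :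
    Measurable[m ⊔ MeasurableSpace.comap V inferInstance] fun ω => Ψ (ω, V ω) := by
  have h1 : @Measurable Ω Ω (m ⊔ MeasurableSpace.comap V inferInstance) m id :=
    measurable_id.mono le_sup_left le_rfl
  have h2 : Measurable[m ⊔ MeasurableSpace.comap V inferInstance] V :=
    (comap_measurable V).mono le_sup_right le_rfl
  exact hΨ.comp (@Measurable.prodMk _ _ _ _ _ (_) _ _ h1 h2)

theorem measurable_section_action {T β : Type*} {_ : MeasurableSpace T} [MeasurableSpace β]
    {K d : ℕ} {Φ : T × (Fin K × Ctx d) → β} (hΦ : Measurable Φ) (a : Fin K) :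
    Measurable fun z : T × Ctx d => Φ (z.1, (a, z.2)) := by fun_prop

theorem measurable_sum_section_action {T : Type*} {_ : MeasurableSpace T} {K d : ℕ}
    {Φ : T × (Fin K × Ctx d) → ℝ≥0∞} (hΦ : Measurable Φ) :
    Measurable fun z : T × Ctx d => ∑ a, Φ (z.1, (a, z.2)) := by fun_prop

section Bandit

variable {Ω : Type*} [mΩ : MeasurableSpace Ω] {K d : ℕ} {μ : Measure Ω}
  {Q : Measure (Ctx d)} {κ : Kernel (Fin K × Ctx d) (Fin 2)} {t : ℕ}
  {g : ℕ → Ω → Fin K × Ctx d → ℝ} {W : ℕ → Ω → Ctx d} {A : ℕ → Ω → Fin K} {Y : ℕ → Ω → Fin 2}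

theorem IsContextualBandit.history_le (hb : IsContextualBandit μ Q κ t g W A Y) {n : ℕ}
    (hn : n ≤ t) : history W A Y n ≤ mΩ := by
  refine iSup₂_le fun s hs => ?_
  have hs' : s ∈ Finset.Icc 1 t := Finset.mem_Icc.2 ⟨hs.1, hs.2.trans hn⟩
  exact ((hb.measurable_context s hs').prodMk
    ((hb.measurable_action s hs').prodMk (hb.measurable_reward s hs'))).comap_le

/-- The tower property in three stages: condition the reward on action and context, then the action
on the context, then use independence of the context from the past. The factor `K` undoes the
uniform weight of the actions in `refDesignLaw`. -/
theorem IsContextualBandit.lintegral_round [IsProbabilityMeasure μ] [IsProbabilityMeasure Q]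
    [NeZero K]
    (hb : IsContextualBandit μ Q κ t g W A Y) {τ : ℕ} (hτ : τ ∈ Finset.Icc 1 t)
    (hg : IsMeasurableDesign (history W A Y (τ - 1)) (g τ))
    {Ψ : Ω × (Fin K × Ctx d) → ℝ≥0∞}
    (hΨ : Measurable[(history W A Y (τ - 1)).prod inferInstance] Ψ) :
    ∫⁻ ω, Ψ (ω, (A τ ω, W τ ω)) * ENNReal.ofReal (if Y τ ω = 0 then 1 else 0) ∂μ =
      ∫⁻ ω, ∫⁻ p, K * (Ψ (ω, p) * ENNReal.ofReal ((κ p).real {0}) * ENNReal.ofReal (g τ ω p))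
        ∂(refDesignLaw Q) ∂μ := by
  have hm : history W A Y (τ - 1) ≤ mΩ :=
    hb.history_le ((Nat.sub_le _ _).trans (Finset.mem_Icc.1 hτ).2)
  have hW := hb.measurable_context τ hτ
  have hA := hb.measurable_action τ hτ
  have hY := hb.measurable_reward τ hτ
  have hκ : Measurable fun p : Fin K × Ctx d => ENNReal.ofReal ((κ p).real {0}) :=
    (κ.measurable_coe (measurableSet_singleton 0)).ennreal_toReal.ennreal_ofReal
  have hsnd : @Measurable _ _ ((history W A Y (τ - 1)).prod inferInstance) _
      (Prod.snd : Ω × (Fin K × Ctx d) → _) :=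
    @measurable_snd _ _ (history W A Y (τ - 1)) _
  have hΨ' : Measurable[(history W A Y (τ - 1)).prod inferInstance]
      fun z : Ω × (Fin K × Ctx d) => Ψ z * ENNReal.ofReal ((κ z.2).real {0}) :=
    hΨ.mul (hκ.comp hsnd)
  have hΦ : Measurable[(history W A Y (τ - 1)).prod inferInstance] fun z : Ω × (Fin K × Ctx d) =>
      Ψ z * ENNReal.ofReal ((κ z.2).real {0}) * ENNReal.ofReal (g τ z.1 z.2) :=
    hΨ'.mul (Measurable.ennreal_ofReal hg)
  have s1 := lintegral_mul_ite_eq_of_condExp (sup_le hm (hA.prodMk hW).comap_le) hY 0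
    (hb.reward_law τ hτ 0) (measurable_comp_graph hΨ fun ω => (A τ ω, W τ ω))
  have s2 (a : Fin K) := lintegral_mul_ite_eq_of_condExp (sup_le hm hW.comap_le) hA a
    (hb.action_law τ hτ a)
    (measurable_comp_graph (measurable_section_action hΨ' a) (W τ))
  have hmeas (a : Fin K) : Measurable fun ω =>
      Ψ (ω, (a, W τ ω)) * ENNReal.ofReal ((κ (a, W τ ω)).real {0}) :=
    (measurable_comp_graph (measurable_section_action hΨ' a) (W τ)).mono
      (sup_le hm hW.comap_le) le_rfl
  have hgm (a : Fin K) : Measurable fun ω => g τ ω (a, W τ ω) :=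
    (measurable_comp_graph (measurable_section_action hg a) (W τ)).mono
      (sup_le hm hW.comap_le) le_rfl
  have hind : ∀ a, Measurable fun ω =>
      ENNReal.ofReal (if A τ ω = a then 1 else 0) := fun a =>
    (Measurable.ite (hA (measurableSet_singleton a)) measurable_const
      measurable_const).ennreal_ofReal
  calc ∫⁻ ω, Ψ (ω, (A τ ω, W τ ω)) * ENNReal.ofReal (if Y τ ω = 0 then 1 else 0) ∂μ
      = ∫⁻ ω, Ψ (ω, (A τ ω, W τ ω)) *
          ENNReal.ofReal ((κ (A τ ω, W τ ω)).real {0}) ∂μ := by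
        exact s1
    _ = ∫⁻ ω, ∑ a, Ψ (ω, (a, W τ ω)) * ENNReal.ofReal ((κ (a, W τ ω)).real {0}) *
          ENNReal.ofReal (if A τ ω = a then 1 else 0) ∂μ := by
        refine lintegral_congr fun ω => ?_
        rw [Finset.sum_eq_single (A τ ω)]
        · simp
        · intro b _ hba
          simp [hba.symm]
        · simp
    _ = ∑ a, ∫⁻ ω, Ψ (ω, (a, W τ ω)) * ENNReal.ofReal ((κ (a, W τ ω)).real {0}) *
          ENNReal.ofReal (g τ ω (a, W τ ω)) ∂μ := by
        refine (lintegral_finsetSum _ fun a _ => (hmeas a).mul (hind a)).trans ?_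
        exact Finset.sum_congr rfl fun a _ => s2 a
    _ = ∫⁻ ω, ∑ a, Ψ (ω, (a, W τ ω)) * ENNReal.ofReal ((κ (a, W τ ω)).real {0}) *
          ENNReal.ofReal (g τ ω (a, W τ ω)) ∂μ := by
        exact (lintegral_finsetSum _ fun a _ => (hmeas a).mul (hgm a).ennreal_ofReal).symm
    _ = _ := by
        rw [lintegral_of_indep hm hW (hb.context_indep τ hτ)
          (measurable_sum_section_action hΦ), hb.context_law τ hτ]
        refine lintegral_congr fun ω => ?_
        have hω : Measurable fun p : Fin K × Ctx d =>
            Ψ (ω, p) * ENNReal.ofReal ((κ p).real {0}) * ENNReal.ofReal (g τ ω p) :=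
          hΦ.comp (@measurable_prodMk_left _ _ (history W A Y (τ - 1)) _ ω)
        rw [lintegral_const_mul _ hω, lintegral_refDesignLaw Q hω, ← mul_assoc,
          ENNReal.mul_inv_cancel (by simp [NeZero.ne K]) (by simp), one_mul]

end Bandit

/-! ### Conditional moments of the importance-weighted loss -/

theorem one_sub_reward (y : Fin 2) : (1 : ℝ) - ((y : ℕ) : ℝ) = if y = 0 then 1 else 0 := by
  fin_cases y <;> simp

instance isProbabilityMeasure_refDesignLaw {K d : ℕ} [NeZero K] (Q : Measure (Ctx d))
    [IsProbabilityMeasure Q] :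
    IsProbabilityMeasure (refDesignLaw (K := K) Q) := by
  unfold refDesignLaw; infer_instance

instance isProbabilityMeasure_refLaw {K d : ℕ} [NeZero K] (Q : Measure (Ctx d))
    [IsProbabilityMeasure Q] (κ : Kernel (Fin K × Ctx d) (Fin 2)) [IsMarkovKernel κ] :
    IsProbabilityMeasure (refLaw Q κ) := by
  unfold refLaw; infer_instance

theorem measurable_loss_id {K d : ℕ} {q : Fin K × Ctx d → ℝ} (hq : Measurable q) :
    Measurable fun o : (Fin K × Ctx d) × Fin 2 => loss id q o.1.2 o.1.1 o.2 := by
  have : Measurable fun y : Fin 2 => (1 : ℝ) - ((y : ℕ) : ℝ) := measurable_of_countable _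
  exact (hq.comp measurable_fst).mul (this.comp measurable_snd)

theorem abs_loss_id_le {K d : ℕ} (q : Fin K × Ctx d → ℝ) (w : Ctx d) (a : Fin K) (y : Fin 2) :
    |loss id q w a y| ≤ |q (a, w)| := by
  rw [loss, one_sub_reward]
  split_ifs <;> simp

theorem integrable_loss_id {K d : ℕ} [NeZero K] (Q : Measure (Ctx d)) [IsProbabilityMeasure Q]
    (κ : Kernel (Fin K × Ctx d) (Fin 2)) [IsMarkovKernel κ] {q : Fin K × Ctx d → ℝ}
    (hq : Measurable q) {C : ℝ} (hC : ∀ p, |q p| ≤ C) :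
    Integrable (fun o : (Fin K × Ctx d) × Fin 2 => loss id q o.1.2 o.1.1 o.2) (refLaw Q κ) :=
  (integrable_const C).mono' (measurable_loss_id hq).aestronglyMeasurable
    (Filter.Eventually.of_forall fun _ => (abs_loss_id_le q _ _ _).trans (hC _))

theorem ofReal_risk_id {K d : ℕ} [NeZero K] (Q : Measure (Ctx d)) [IsProbabilityMeasure Q]
    (κ : Kernel (Fin K × Ctx d) (Fin 2)) [IsMarkovKernel κ] {q : Fin K × Ctx d → ℝ}
    (hq : Measurable q) (hq0 : ∀ p, 0 ≤ q p) {C : ℝ} (hC : ∀ p, q p ≤ C) :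
    ENNReal.ofReal (risk Q κ id q) =
      ∫⁻ p, ENNReal.ofReal (q p) * ENNReal.ofReal ((κ p).real {0}) ∂(refDesignLaw Q) := by
  rw [risk, ofReal_integral_eq_lintegral_ofReal
    (integrable_loss_id Q κ hq fun p => (abs_of_nonneg (hq0 p)).trans_le (hC p))
    (Filter.Eventually.of_forall fun o => by
      dsimp only [Pi.zero_apply]
      rw [loss, one_sub_reward]
      split_ifs
      · simpa using hq0 _
      · simp), refLaw, Measure.lintegral_compProd (measurable_loss_id hq).ennreal_ofReal]
  refine lintegral_congr fun p => ?_
  rw [lintegral_fintype, Fin.sum_univ_two]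
  simp [loss]

theorem measurable_lintegral_sum_section_action {T : Type*} {_ : MeasurableSpace T} {K d : ℕ}
    {Φ : T × (Fin K × Ctx d) → ℝ≥0∞} (hΦ : Measurable Φ) (Q : Measure (Ctx d)) [SFinite Q] :
    Measurable fun x => ∫⁻ w, ∑ a, Φ (x, (a, w)) ∂Q :=
  (measurable_sum_section_action hΦ).lintegral_prod_right'

section Bandit

variable {Ω : Type*} [mΩ : MeasurableSpace Ω] {K d : ℕ} {μ : Measure Ω}
  {Q : Measure (Ctx d)} {κ : Kernel (Fin K × Ctx d) (Fin 2)} {t : ℕ}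
  {g : ℕ → Ω → Fin K × Ctx d → ℝ} {W : ℕ → Ω → Ctx d} {A : ℕ → Ω → Fin K} {Y : ℕ → Ω → Fin 2}

/-- The lower bound is known only at the realized context. As `g τ` depends on the past alone and `W
τ` is a fresh draw from `Q`, the expected violation at `W τ` equals the one averaged over `Q`, so
both vanish. -/
theorem IsContextualBandit.ae_ae_le_design [IsProbabilityMeasure μ] [IsProbabilityMeasure Q]
    [NeZero K]
    (hb : IsContextualBandit μ Q κ t g W A Y) {τ : ℕ} (hτ : τ ∈ Finset.Icc 1 t)
    (hg : IsMeasurableDesign (history W A Y (τ - 1)) (g τ)) {δ : ℝ}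
    (hlower : ∀ᵐ ω ∂μ, ∀ a, δ ≤ g τ ω (a, W τ ω)) :
    ∀ᵐ ω ∂μ, ∀ᵐ p ∂(refDesignLaw Q), δ ≤ g τ ω p := by
  have hm : history W A Y (τ - 1) ≤ mΩ :=
    hb.history_le ((Nat.sub_le _ _).trans (Finset.mem_Icc.1 hτ).2)
  set Φ : Ω × (Fin K × Ctx d) → ℝ≥0∞ := fun z => if δ ≤ g τ z.1 z.2 then 0 else 1 with hΦdef
  have hΦ : Measurable[(history W A Y (τ - 1)).prod inferInstance] Φ :=
    Measurable.ite (measurableSet_le measurable_const hg) measurable_const measurable_const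
  have h1 : ∫⁻ ω, ∑ a, Φ (ω, (a, W τ ω)) ∂μ = 0 := by
    rw [lintegral_eq_zero_of_ae_eq_zero]
    filter_upwards [hlower] with ω hω
    simp [hΦdef, hω]
  rw [lintegral_of_indep (Ψ := fun z : Ω × Ctx d => ∑ a, Φ (z.1, (a, z.2))) hm
    (hb.measurable_context τ hτ) (hb.context_indep τ hτ)
    (measurable_sum_section_action hΦ), hb.context_law τ hτ] at h1
  have h2 : Measurable[history W A Y (τ - 1)]
      fun ω => ∫⁻ w, ∑ a, Φ (ω, (a, w)) ∂Q :=
    measurable_lintegral_sum_section_action hΦ Q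
  rw [lintegral_eq_zero_iff (h2.mono hm le_rfl)] at h1
  filter_upwards [h1] with ω hω
  have hω' : Measurable fun p => Φ (ω, p) := hΦ.comp (@measurable_prodMk_left _ _ (_) _ ω)
  have h3 : ∫⁻ p, Φ (ω, p) ∂(refDesignLaw Q) = 0 := by
    rw [lintegral_refDesignLaw Q hω']
    simp only [Pi.zero_apply] at hω
    rw [hω, mul_zero]
  rw [lintegral_eq_zero_iff hω'] at h3
  filter_upwards [h3] with p hp
  by_contra hcon
  simp [hΦdef, hcon] at hp

/-- Unbiasedness given the past, tested against `Z`: the weight `1 / (K g)` cancels the design,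
which is legitimate because `g ≥ δ > 0` almost everywhere. -/
theorem IsContextualBandit.lintegral_mul_isLoss [IsProbabilityMeasure μ]
    [IsProbabilityMeasure Q] [IsMarkovKernel κ] [NeZero K]
    (hb : IsContextualBandit μ Q κ t g W A Y) {τ : ℕ} (hτ : τ ∈ Finset.Icc 1 t)
    (hg0 : ∀ ω, IsPolicy (g τ ω))
    (hg : IsMeasurableDesign (history W A Y (τ - 1)) (g τ)) {δ : ℝ} (hδ : 0 < δ)
    (hlower : ∀ᵐ ω ∂μ, ∀ a, δ ≤ g τ ω (a, W τ ω))
    {Z : Ω → ℝ≥0∞} (hZ : Measurable[history W A Y (τ - 1)] Z)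
    {q : Fin K × Ctx d → ℝ} (hq : Measurable q) (hq0 : ∀ p, 0 ≤ q p) {C : ℝ}
    (hC : ∀ p, q p ≤ C) :
    ∫⁻ ω, Z ω * ENNReal.ofReal (isLoss id (g τ ω) q (W τ ω) (A τ ω) (Y τ ω)) ∂μ =
      (∫⁻ ω, Z ω ∂μ) * ENNReal.ofReal (risk Q κ id q) := by
  have hm : history W A Y (τ - 1) ≤ mΩ :=
    hb.history_le ((Nat.sub_le _ _).trans (Finset.mem_Icc.1 hτ).2)
  have hfst : @Measurable _ _ ((history W A Y (τ - 1)).prod inferInstance) (history W A Y (τ - 1))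
    (Prod.fst : Ω × (Fin K × Ctx d) → _) := @measurable_fst _ _ (_) _
  have hsnd : @Measurable _ _ ((history W A Y (τ - 1)).prod inferInstance) _
    (Prod.snd : Ω × (Fin K × Ctx d) → _) := @measurable_snd _ _ (_) _
  have hΨ : Measurable[(history W A Y (τ - 1)).prod inferInstance]
      fun z : Ω × (Fin K × Ctx d) =>
        Z z.1 * ENNReal.ofReal ((K : ℝ)⁻¹ / g τ z.1 z.2 * q z.2) :=
    (hZ.comp hfst).mul (Measurable.ennreal_ofReal
      ((measurable_const.div hg).mul (hq.comp hsnd)))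
  have hK : (0 : ℝ) < K := Nat.cast_pos.2 (NeZero.pos K)
  rw [← lintegral_mul_const _ (hZ.mono hm le_rfl)]
  calc _ = ∫⁻ ω, (Z ω * ENNReal.ofReal ((K : ℝ)⁻¹ / g τ ω (A τ ω, W τ ω) * q (A τ ω, W τ ω))) *
          ENNReal.ofReal (if Y τ ω = 0 then 1 else 0) ∂μ := by
        refine lintegral_congr fun ω => ?_
        rw [isLoss, loss, one_sub_reward, mul_assoc, ← ENNReal.ofReal_mul]
        · simp only [gRef, id, mul_assoc]
        · exact mul_nonneg (div_nonneg (by positivity) ((hg0 ω).1 _ _)) (hq0 _)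
    _ = _ := hb.lintegral_round hτ hg hΨ
    _ = _ := by
        refine lintegral_congr_ae ?_
        filter_upwards [hb.ae_ae_le_design hτ hg hlower] with ω hω
        rw [ofReal_risk_id Q κ hq hq0 hC, ← lintegral_const_mul]
        · refine lintegral_congr_ae ?_
          filter_upwards [hω] with p hp
          have hgp : 0 < g τ ω p := hδ.trans_le hp
          have e : ENNReal.ofReal (q p) = K * (ENNReal.ofReal ((K : ℝ)⁻¹ / g τ ω p * q p) *
              ENNReal.ofReal (g τ ω p)) := by
            rw [← ENNReal.ofReal_natCast, ← ENNReal.ofReal_mul', ← ENNReal.ofReal_mul hK.le]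
            · congr 1
              field_simp
            · exact hgp.le
          rw [e]
          ring
        · exact hq.ennreal_ofReal.mul
            (κ.measurable_coe (measurableSet_singleton 0)).ennreal_toReal.ennreal_ofReal

/-- Of the squared weight `1 / (K g)²` one factor is absorbed by the design and the other is at most
`1 / (K δ)`. Hence the `L²` norm under the reference law controls the conditional second moment. -/
theorem IsContextualBandit.lintegral_mul_isLoss_sq_le [IsProbabilityMeasure μ]
    [IsProbabilityMeasure Q] [IsMarkovKernel κ] [NeZero K]
    (hb : IsContextualBandit μ Q κ t g W A Y) {τ : ℕ} (hτ : τ ∈ Finset.Icc 1 t)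
    (hg : IsMeasurableDesign (history W A Y (τ - 1)) (g τ)) {δ : ℝ} (hδ : 0 < δ)
    (hlower : ∀ᵐ ω ∂μ, ∀ a, δ ≤ g τ ω (a, W τ ω))
    {Z : Ω → ℝ≥0∞} (hZ : Measurable[history W A Y (τ - 1)] Z)
    {q : Fin K × Ctx d → ℝ} (hq : Measurable q) {s : ℝ}
    (hs : ∫⁻ p, ENNReal.ofReal (q p ^ 2) ∂(refDesignLaw Q) ≤ ENNReal.ofReal (K * δ * s)) :
    ∫⁻ ω, Z ω * ENNReal.ofReal (isLoss id (g τ ω) q (W τ ω) (A τ ω) (Y τ ω) ^ 2) ∂μ ≤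
      (∫⁻ ω, Z ω ∂μ) * ENNReal.ofReal s := by
  have hm : history W A Y (τ - 1) ≤ mΩ :=
    hb.history_le ((Nat.sub_le _ _).trans (Finset.mem_Icc.1 hτ).2)
  have hfst : @Measurable _ _ ((history W A Y (τ - 1)).prod inferInstance) (history W A Y (τ - 1))
    (Prod.fst : Ω × (Fin K × Ctx d) → _) := @measurable_fst _ _ (_) _
  have hsnd : @Measurable _ _ ((history W A Y (τ - 1)).prod inferInstance) _
    (Prod.snd : Ω × (Fin K × Ctx d) → _) := @measurable_snd _ _ (_) _
  have hΨ : Measurable[(history W A Y (τ - 1)).prod inferInstance]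
      fun z : Ω × (Fin K × Ctx d) =>
        Z z.1 * ENNReal.ofReal (((K : ℝ)⁻¹ / g τ z.1 z.2 * q z.2) ^ 2) :=
    (hZ.comp hfst).mul (Measurable.ennreal_ofReal
      (((measurable_const.div hg).mul (hq.comp hsnd)).pow_const 2))
  have hK : (0 : ℝ) < K := Nat.cast_pos.2 (NeZero.pos K)
  rw [← lintegral_mul_const _ (hZ.mono hm le_rfl)]
  calc _ = ∫⁻ ω, (Z ω *
          ENNReal.ofReal (((K : ℝ)⁻¹ / g τ ω (A τ ω, W τ ω) * q (A τ ω, W τ ω)) ^ 2)) *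
          ENNReal.ofReal (if Y τ ω = 0 then 1 else 0) ∂μ := by
        refine lintegral_congr fun ω => ?_
        rw [isLoss, loss, one_sub_reward, mul_assoc, ← ENNReal.ofReal_mul (sq_nonneg _)]
        congr 2
        split_ifs <;> simp [gRef]
    _ = _ := hb.lintegral_round hτ hg hΨ
    _ ≤ _ := by
        refine lintegral_mono_ae ?_
        filter_upwards [hb.ae_ae_le_design hτ hg hlower] with ω hω
        calc _ ≤ ∫⁻ p, Z ω * ENNReal.ofReal ((K * δ)⁻¹) * ENNReal.ofReal (q p ^ 2)
                ∂(refDesignLaw Q) := by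
              refine lintegral_mono_ae ?_
              filter_upwards [hω] with p hp
              have hgp : 0 < g τ ω p := hδ.trans_le hp
              have e : K * (ENNReal.ofReal (((K : ℝ)⁻¹ / g τ ω p * q p) ^ 2) *
                  ENNReal.ofReal ((κ p).real {0}) * ENNReal.ofReal (g τ ω p)) ≤
                  ENNReal.ofReal ((K * δ)⁻¹) * ENNReal.ofReal (q p ^ 2) := by
                rw [← ENNReal.ofReal_natCast, ← ENNReal.ofReal_mul (sq_nonneg _),
                  ← ENNReal.ofReal_mul' hgp.le, ← ENNReal.ofReal_mul hK.le,
                  ← ENNReal.ofReal_mul (by positivity)]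
                refine ENNReal.ofReal_le_ofReal ?_
                have h1 : (κ p).real {0} ≤ 1 := measureReal_le_one
                calc (K : ℝ) * (((K : ℝ)⁻¹ / g τ ω p * q p) ^ 2 * (κ p).real {0} * g τ ω p)
                    ≤ (K : ℝ) * (((K : ℝ)⁻¹ / g τ ω p * q p) ^ 2 * 1 * g τ ω p) := by gcongr
                  _ = (K * g τ ω p)⁻¹ * q p ^ 2 := by field_simp
                  _ ≤ (K * δ)⁻¹ * q p ^ 2 := by gcongr
              calc _ = Z ω * (K * (ENNReal.ofReal (((K : ℝ)⁻¹ / g τ ω p * q p) ^ 2) *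
                  ENNReal.ofReal ((κ p).real {0}) * ENNReal.ofReal (g τ ω p))) := by ring
                _ ≤ _ := (mul_le_mul_right e (Z ω)).trans_eq (mul_assoc _ _ _).symm
          _ ≤ Z ω * ENNReal.ofReal s := by
              rw [lintegral_const_mul _ (hq.pow_const 2).ennreal_ofReal, mul_assoc]
              refine mul_le_mul_right ((mul_le_mul_right hs _).trans_eq ?_) _
              rw [← ENNReal.ofReal_mul (by positivity)]
              congr 1
              field_simp

end Bandit

/-! ### Exponential moments and deviation inequalities -/

theorem exp_le_one_add_add_sq {y : ℝ} (hy : y ≤ 1) : Real.exp y ≤ 1 + y + y ^ 2 := by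
  rcases le_total 0 y with h | h
  · have := Real.abs_exp_sub_one_sub_id_le (x := y) (by rw [abs_of_nonneg h]; exact hy)
    have := (abs_le.1 this).2
    linarith
  · have h1 := Real.quadratic_le_exp_of_nonneg (neg_nonneg.2 h)
    have h2 : Real.exp y * Real.exp (-y) = 1 := by rw [← Real.exp_add]; simp
    have h3 : 0 < 1 + y + y ^ 2 := by nlinarith [sq_nonneg (y + 1 / 2)]
    -- The product equals `1 + y²/2 - y³/2 + y⁴/2`, and `y ≤ 0`.
    have h4 : 1 ≤ (1 + y + y ^ 2) * (1 + -y + (-y) ^ 2 / 2) := by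
      nlinarith [sq_nonneg y, sq_nonneg (y * (y - 1)), mul_nonneg (neg_nonneg.2 h) (sq_nonneg y),
        sq_nonneg (y ^ 2)]
    have h5 : 1 ≤ (1 + y + y ^ 2) * Real.exp (-y) := h4.trans (by gcongr)
    calc Real.exp y = Real.exp y * 1 := by ring
      _ ≤ Real.exp y * ((1 + y + y ^ 2) * Real.exp (-y)) := by gcongr
      _ = (1 + y + y ^ 2) * (Real.exp y * Real.exp (-y)) := by ring
      _ = _ := by rw [h2, mul_one]

/-- The importance-sampling weighted value of `q` in round `τ`. -/
noncomputable def weightedValue {Ω : Type*} {K d : ℕ} (g : ℕ → Ω → Fin K × Ctx d → ℝ)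
    (W : ℕ → Ω → Ctx d) (A : ℕ → Ω → Fin K) (Y : ℕ → Ω → Fin 2) (q : Fin K × Ctx d → ℝ)
    (τ : ℕ) (ω : Ω) : ℝ :=
  isLoss id (g τ ω) q (W τ ω) (A τ ω) (Y τ ω)

section Bandit

variable {Ω : Type*} {K d : ℕ} {g : ℕ → Ω → Fin K × Ctx d → ℝ} {W : ℕ → Ω → Ctx d}
  {A : ℕ → Ω → Fin K} {Y : ℕ → Ω → Fin 2}

theorem weightedValue_nonneg {τ : ℕ} {ω : Ω} (hg0 : IsPolicy (g τ ω))
    {q : Fin K × Ctx d → ℝ} (hq0 : ∀ p, 0 ≤ q p) : 0 ≤ weightedValue g W A Y q τ ω := by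
  rw [weightedValue, isLoss, loss, one_sub_reward]
  refine mul_nonneg (div_nonneg (by unfold gRef; positivity) (hg0.1 _ _))
    (mul_nonneg (hq0 _) ?_)
  split_ifs <;> simp

theorem weightedValue_le {τ : ℕ} {ω : Ω} {δ : ℝ} (hδ : 0 < δ)
    (hg : ∀ a, δ ≤ g τ ω (a, W τ ω))
    {q : Fin K × Ctx d → ℝ} {C : ℝ} (hC : ∀ p, |q p| ≤ C) :
    weightedValue g W A Y q τ ω ≤ C / (K * δ) := by
  have hC0 : 0 ≤ C := (abs_nonneg _).trans (hC (A τ ω, W τ ω))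
  have h1 : loss id q (W τ ω) (A τ ω) (Y τ ω) ≤ C :=
    (le_abs_self _).trans ((abs_loss_id_le _ _ _ _).trans (hC _))
  have hpos := hδ.trans_le (hg (A τ ω))
  calc weightedValue g W A Y q τ ω ≤ (K : ℝ)⁻¹ / g τ ω (A τ ω, W τ ω) * C := by
        unfold weightedValue isLoss gRef
        exact mul_le_mul_of_nonneg_left h1 (by positivity)
    _ ≤ (K : ℝ)⁻¹ / δ * C := by gcongr; exact hg _
    _ = C / (K * δ) := by rw [div_mul_eq_mul_div, inv_mul_eq_div, div_div]

theorem measurable_history_weightedValue {τ : ℕ} (hτ : 1 ≤ τ)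
    (hg : IsMeasurableDesign (history W A Y (τ - 1)) (g τ))
    {q : Fin K × Ctx d → ℝ} (hq : Measurable q) :
    Measurable[history W A Y τ] (weightedValue g W A Y q τ) := by
  have hO : Measurable[history W A Y τ] fun ω => (W τ ω, A τ ω, Y τ ω) :=
    Measurable.mono (comap_measurable _) (le_iSup₂_of_le τ ⟨hτ, le_rfl⟩ le_rfl) le_rfl
  have hle : history W A Y (τ - 1) ≤ history W A Y τ :=
    biSup_mono fun s hs => ⟨hs.1, hs.2.trans (Nat.sub_le _ _)⟩
  have hAW : Measurable[history W A Y τ] fun ω => (A τ ω, W τ ω) :=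
    (measurable_snd.fst.prodMk measurable_fst).comp hO
  have hgm : Measurable[history W A Y τ] fun ω => g τ ω (A τ ω, W τ ω) :=
    (measurable_comp_graph (Ψ := Function.uncurry (g τ)) hg fun ω => (A τ ω, W τ ω)).mono
      (sup_le hle hAW.comap_le) le_rfl
  have hY : Measurable[history W A Y τ] fun ω => (1 : ℝ) - ((Y τ ω : ℕ) : ℝ) :=
    (measurable_of_countable fun y : Fin 2 => (1 : ℝ) - ((y : ℕ) : ℝ)).comp
      (measurable_snd.snd.comp hO)
  exact (measurable_const.div hgm).mul ((hq.comp hAW).mul hY)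

variable [mΩ : MeasurableSpace Ω] {μ : Measure Ω} {Q : Measure (Ctx d)}
  {κ : Kernel (Fin K × Ctx d) (Fin 2)} {t : ℕ}

theorem IsContextualBandit.integral_mul_weightedValue [IsProbabilityMeasure μ]
    [IsProbabilityMeasure Q] [IsMarkovKernel κ] [NeZero K]
    (hb : IsContextualBandit μ Q κ t g W A Y) {τ : ℕ} (hτ : τ ∈ Finset.Icc 1 t)
    (hg0 : ∀ ω, IsPolicy (g τ ω))
    (hg : IsMeasurableDesign (history W A Y (τ - 1)) (g τ)) {δ : ℝ} (hδ : 0 < δ)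
    (hlower : ∀ᵐ ω ∂μ, ∀ a, δ ≤ g τ ω (a, W τ ω))
    {Z : Ω → ℝ} (hZ : Measurable[history W A Y (τ - 1)] Z) (hZ0 : ∀ ω, 0 ≤ Z ω)
    (hZi : Integrable Z μ)
    {q : Fin K × Ctx d → ℝ} (hq : Measurable q) (hq0 : ∀ p, 0 ≤ q p) {C : ℝ}
    (hC : ∀ p, q p ≤ C) {s : ℝ} (hs0 : 0 ≤ s)
    (hs : ∫⁻ p, ENNReal.ofReal (q p ^ 2) ∂(refDesignLaw Q) ≤ ENNReal.ofReal (K * δ * s)) :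
    Integrable (fun ω => Z ω * weightedValue g W A Y q τ ω) μ ∧
      ∫ ω, Z ω * weightedValue g W A Y q τ ω ∂μ = (∫ ω, Z ω ∂μ) * risk Q κ id q ∧
      Integrable (fun ω => Z ω * weightedValue g W A Y q τ ω ^ 2) μ ∧
      ∫ ω, Z ω * weightedValue g W A Y q τ ω ^ 2 ∂μ ≤ (∫ ω, Z ω ∂μ) * s := by
  obtain ⟨h1τ, hτt⟩ := Finset.mem_Icc.1 hτ
  have hZm : Measurable Z := hZ.mono (hb.history_le ((Nat.sub_le _ _).trans hτt)) le_rfl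
  have hXm : Measurable (weightedValue g W A Y q τ) :=
    (measurable_history_weightedValue h1τ hg hq).mono (hb.history_le hτt) le_rfl
  have hX0 : ∀ ω, 0 ≤ weightedValue g W A Y q τ ω := fun ω => weightedValue_nonneg (hg0 ω) hq0
  have hr0 : 0 ≤ risk Q κ id q := by
    refine integral_nonneg fun o => ?_
    rw [loss, one_sub_reward]
    exact mul_nonneg (hq0 _) (by split_ifs <;> simp)
  have hZ0' : 0 ≤ ∫ ω, Z ω ∂μ := integral_nonneg hZ0
  have hL : ∫⁻ ω, ENNReal.ofReal (Z ω) ∂μ = ENNReal.ofReal (∫ ω, Z ω ∂μ) :=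
    (ofReal_integral_eq_lintegral_ofReal hZi (Filter.Eventually.of_forall hZ0)).symm
  have h1 := hb.lintegral_mul_isLoss hτ hg0 hg hδ hlower hZ.ennreal_ofReal hq hq0 hC
  have h2 := hb.lintegral_mul_isLoss_sq_le hτ hg hδ hlower hZ.ennreal_ofReal hq hs
  simp_rw [← ENNReal.ofReal_mul (hZ0 _)] at h1 h2
  rw [hL, ← ENNReal.ofReal_mul hZ0'] at h1 h2
  have i1 : Integrable (fun ω => Z ω * weightedValue g W A Y q τ ω) μ := by
    refine (lintegral_ofReal_ne_top_iff_integrable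
      (f := fun ω => Z ω * weightedValue g W A Y q τ ω) (hZm.mul hXm).aestronglyMeasurable
      (Filter.Eventually.of_forall fun ω => mul_nonneg (hZ0 ω) (hX0 ω))).1 ?_
    exact h1.trans_ne ENNReal.ofReal_ne_top
  have i2 : Integrable (fun ω => Z ω * weightedValue g W A Y q τ ω ^ 2) μ := by
    refine (lintegral_ofReal_ne_top_iff_integrable
      (f := fun ω => Z ω * weightedValue g W A Y q τ ω ^ 2)
      (hZm.mul (hXm.pow_const 2)).aestronglyMeasurable
      (Filter.Eventually.of_forall fun ω => mul_nonneg (hZ0 ω) (sq_nonneg _))).1 ?_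
    exact (h2.trans_lt ENNReal.ofReal_lt_top).ne
  refine ⟨i1, ?_, i2, ?_⟩
  · rw [integral_eq_lintegral_of_nonneg_ae
      (Filter.Eventually.of_forall fun ω => mul_nonneg (hZ0 ω) (hX0 ω)) i1.1]
    exact (congrArg ENNReal.toReal h1).trans (ENNReal.toReal_ofReal (mul_nonneg hZ0' hr0))
  · rw [integral_eq_lintegral_of_nonneg_ae
      (Filter.Eventually.of_forall fun ω => mul_nonneg (hZ0 ω) (sq_nonneg _)) i2.1]
    exact ENNReal.toReal_le_of_le_ofReal (mul_nonneg hZ0' hs0) h2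

/-- The exponential of the centered sum picks up at most a factor `exp (θ² s)` per round. Given the
past, `e^{θX} ≤ 1 + θX + θ²X²` has mean at most `1 + θR + θ²s ≤ exp (θR + θ²s)`, and the centering
removes `θR`. The hypothesis on `θX` is one-sided, so it is free when `θ ≤ 0 ≤ X`. -/
theorem IsContextualBandit.integral_exp_sum_le [IsProbabilityMeasure μ]
    [IsProbabilityMeasure Q] [IsMarkovKernel κ] [NeZero K]
    (hb : IsContextualBandit μ Q κ t g W A Y)
    (hg0 : ∀ τ ∈ Finset.Icc 1 t, ∀ ω, IsPolicy (g τ ω))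
    (hg : ∀ τ ∈ Finset.Icc 1 t, IsMeasurableDesign (history W A Y (τ - 1)) (g τ))
    {δ : ℝ} (hδ : 0 < δ)
    (hlower : ∀ τ ∈ Finset.Icc 1 t, ∀ᵐ ω ∂μ, ∀ a, δ ≤ g τ ω (a, W τ ω))
    {q : Fin K × Ctx d → ℝ} (hq : Measurable q) (hq0 : ∀ p, 0 ≤ q p) {C : ℝ}
    (hC : ∀ p, q p ≤ C) {s : ℝ} (hs0 : 0 ≤ s)
    (hs : ∫⁻ p, ENNReal.ofReal (q p ^ 2) ∂(refDesignLaw Q) ≤ ENNReal.ofReal (K * δ * s))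
    {θ : ℝ} (hθ : ∀ τ ∈ Finset.Icc 1 t, ∀ᵐ ω ∂μ, θ * weightedValue g W A Y q τ ω ≤ 1)
    {n : ℕ} (hn : n ≤ t) :
    Integrable (fun ω => Real.exp
        (θ * ∑ τ ∈ Finset.Icc 1 n, (weightedValue g W A Y q τ ω - risk Q κ id q))) μ ∧
      ∫ ω, Real.exp (θ * ∑ τ ∈ Finset.Icc 1 n,
        (weightedValue g W A Y q τ ω - risk Q κ id q)) ∂μ ≤ Real.exp (n * (θ ^ 2 * s)) := by
  induction n with
  | zero => simp
  | succ n ih =>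
    obtain ⟨ihi, ihb⟩ := ih (Nat.le_of_succ_le hn)
    set Z : Ω → ℝ := fun ω => Real.exp
        (θ * ∑ τ ∈ Finset.Icc 1 n, (weightedValue g W A Y q τ ω - risk Q κ id q)) with hZdef
    set r := risk Q κ id q
    have hτ : n + 1 ∈ Finset.Icc 1 t := Finset.mem_Icc.2 ⟨Nat.le_add_left _ _, hn⟩
    have hZ : Measurable[history W A Y (n + 1 - 1)] Z := by
      rw [Nat.add_sub_cancel]
      refine Real.measurable_exp.comp (measurable_const.mul (Finset.measurable_fun_sum _ ?_))
      intro τ hτn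
      obtain ⟨h1, h2⟩ := Finset.mem_Icc.1 hτn
      refine Measurable.sub_const (Measurable.mono (measurable_history_weightedValue h1
        (hg τ (Finset.mem_Icc.2 ⟨h1, h2.trans (Nat.le_of_succ_le hn)⟩)) hq) ?_ le_rfl) _
      exact biSup_mono fun s hs => ⟨hs.1, hs.2.trans h2⟩
    obtain ⟨i1, e1, i2, e2⟩ := hb.integral_mul_weightedValue hτ (hg0 _ hτ) (hg _ hτ) hδ
      (hlower _ hτ) hZ (fun ω => (Real.exp_pos _).le) ihi hq hq0 hC hs0 hs
    have hXm : Measurable (weightedValue g W A Y q (n + 1)) :=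
      (measurable_history_weightedValue (Nat.le_add_left _ _) (hg _ hτ) hq).mono
        (hb.history_le hn) le_rfl
    have hstep : ∀ ω, Real.exp (θ * ∑ τ ∈ Finset.Icc 1 (n + 1),
        (weightedValue g W A Y q τ ω - r)) =
        Real.exp (-(θ * r)) * (Z ω * Real.exp (θ * weightedValue g W A Y q (n + 1) ω)) := by
      intro ω
      rw [Finset.sum_Icc_succ_top (Nat.le_add_left _ _), hZdef, ← Real.exp_add, ← Real.exp_add]
      congr 1
      ring
    have hdom : ∀ᵐ ω ∂μ, Z ω * Real.exp (θ * weightedValue g W A Y q (n + 1) ω) ≤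
        Z ω + θ * (Z ω * weightedValue g W A Y q (n + 1) ω) +
          θ ^ 2 * (Z ω * weightedValue g W A Y q (n + 1) ω ^ 2) := by
      filter_upwards [hθ _ hτ] with ω hω
      calc _ ≤ Z ω * (1 + θ * weightedValue g W A Y q (n + 1) ω +
            (θ * weightedValue g W A Y q (n + 1) ω) ^ 2) :=
            mul_le_mul_of_nonneg_left (exp_le_one_add_add_sq hω) (Real.exp_pos _).le
        _ = _ := by ring
    have idom := (ihi.add (i1.const_mul θ)).add (i2.const_mul (θ ^ 2))
    have hI : Integrable (fun ω => Z ω * Real.exp (θ * weightedValue g W A Y q (n + 1) ω)) μ := by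
      refine idom.mono' (ihi.1.mul
        (Real.measurable_exp.comp (hXm.const_mul θ)).aestronglyMeasurable) ?_
      filter_upwards [hdom] with ω hω
      rw [Real.norm_of_nonneg (by positivity)]
      exact hω
    simp_rw [hstep]
    refine ⟨hI.const_mul _, ?_⟩
    rw [integral_const_mul]
    have hZpos : 0 ≤ ∫ ω, Z ω ∂μ := integral_nonneg fun ω => (Real.exp_pos _).le
    have hb1 : ∫ ω, Z ω * Real.exp (θ * weightedValue g W A Y q (n + 1) ω) ∂μ ≤
        (∫ ω, Z ω ∂μ) * Real.exp (θ * r + θ ^ 2 * s) := by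
      calc _ ≤ ∫ ω, (Z ω + θ * (Z ω * weightedValue g W A Y q (n + 1) ω) +
          θ ^ 2 * (Z ω * weightedValue g W A Y q (n + 1) ω ^ 2)) ∂μ :=
            integral_mono_ae hI idom hdom
        _ = (∫ ω, Z ω ∂μ) + θ * ((∫ ω, Z ω ∂μ) * r) +
          θ ^ 2 * ∫ ω, Z ω * weightedValue g W A Y q (n + 1) ω ^ 2 ∂μ := by
            have hsum : Integrable
                (fun ω => Z ω + θ * (Z ω * weightedValue g W A Y q (n + 1) ω)) μ :=
              ihi.add (i1.const_mul θ)
            rw [integral_add hsum (i2.const_mul (θ ^ 2)),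
              integral_add ihi (i1.const_mul θ), integral_const_mul, integral_const_mul, e1]
        _ ≤ (∫ ω, Z ω ∂μ) + θ * ((∫ ω, Z ω ∂μ) * r) + θ ^ 2 * ((∫ ω, Z ω ∂μ) * s) := by gcongr
        _ = (∫ ω, Z ω ∂μ) * (θ * r + θ ^ 2 * s + 1) := by ring
        _ ≤ _ := mul_le_mul_of_nonneg_left (Real.add_one_le_exp _) hZpos
    calc _ ≤ Real.exp (-(θ * r)) *
          (Real.exp (n * (θ ^ 2 * s)) * Real.exp (θ * r + θ ^ 2 * s)) := by
          gcongr
          exact hb1.trans (by gcongr)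
      _ = _ := by
          rw [← Real.exp_add, ← Real.exp_add]
          congr 1
          push_cast
          ring

theorem IsContextualBandit.measure_deviation_ge_le [IsProbabilityMeasure μ]
    [IsProbabilityMeasure Q] [IsMarkovKernel κ] [NeZero K]
    (hb : IsContextualBandit μ Q κ t g W A Y)
    (hg0 : ∀ τ ∈ Finset.Icc 1 t, ∀ ω, IsPolicy (g τ ω))
    (hg : ∀ τ ∈ Finset.Icc 1 t, IsMeasurableDesign (history W A Y (τ - 1)) (g τ))
    {δ : ℝ} (hδ : 0 < δ)
    (hlower : ∀ τ ∈ Finset.Icc 1 t, ∀ᵐ ω ∂μ, ∀ a, δ ≤ g τ ω (a, W τ ω))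
    {q : Fin K × Ctx d → ℝ} (hq : Measurable q) (hq0 : ∀ p, 0 ≤ q p) {C : ℝ}
    (hC : ∀ p, q p ≤ C) {s : ℝ} (hs0 : 0 ≤ s)
    (hs : ∫⁻ p, ENNReal.ofReal (q p ^ 2) ∂(refDesignLaw Q) ≤ ENNReal.ofReal (K * δ * s))
    {θ : ℝ} (hθ : ∀ τ ∈ Finset.Icc 1 t, ∀ᵐ ω ∂μ, θ * weightedValue g W A Y q τ ω ≤ 1)
    {u y : ℝ} (hu : y + t * (θ ^ 2 * s) ≤ u) :
    μ {ω | u ≤ θ * ∑ τ ∈ Finset.Icc 1 t, (weightedValue g W A Y q τ ω - risk Q κ id q)} ≤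
      ENNReal.ofReal (Real.exp (-y)) := by
  obtain ⟨hi, hle⟩ := hb.integral_exp_sum_le hg0 hg hδ hlower hq hq0 hC hs0 hs hθ le_rfl
  have h := measure_ge_le_exp_mul_mgf (μ := μ) (X := fun ω => θ * ∑ τ ∈ Finset.Icc 1 t,
    (weightedValue g W A Y q τ ω - risk Q κ id q)) u zero_le_one (by simpa using hi)
  rw [← ofReal_measureReal]
  refine ENNReal.ofReal_le_ofReal (h.trans ?_)
  simp only [mgf, one_mul]
  calc _ ≤ Real.exp (-1 * u) * Real.exp (t * (θ ^ 2 * s)) := by gcongr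
    _ = Real.exp (-1 * u + t * (θ ^ 2 * s)) := (Real.exp_add _ _).symm
    _ ≤ _ := Real.exp_le_exp.2 (by linarith)

end Bandit

section Bandit

variable {Ω : Type*} [mΩ : MeasurableSpace Ω] {K d : ℕ} {μ : Measure Ω}
  {Q : Measure (Ctx d)} {κ : Kernel (Fin K × Ctx d) (Fin 2)} {t : ℕ}
  {g : ℕ → Ω → Fin K × Ctx d → ℝ} {W : ℕ → Ω → Ctx d} {A : ℕ → Ω → Fin K} {Y : ℕ → Ω → Fin 2}

/-- The exponent is negative and the summands are nonnegative, so no cap on `θ` is needed. The bound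
`C` therefore does not enter the threshold. -/
theorem IsContextualBandit.measure_lower_deviation_le [IsProbabilityMeasure μ]
    [IsProbabilityMeasure Q] [IsMarkovKernel κ] [NeZero K]
    (hb : IsContextualBandit μ Q κ t g W A Y) (ht : 1 ≤ t)
    (hg0 : ∀ τ ∈ Finset.Icc 1 t, ∀ ω, IsPolicy (g τ ω))
    (hg : ∀ τ ∈ Finset.Icc 1 t, IsMeasurableDesign (history W A Y (τ - 1)) (g τ))
    {δ : ℝ} (hδ : 0 < δ)
    (hlower : ∀ τ ∈ Finset.Icc 1 t, ∀ᵐ ω ∂μ, ∀ a, δ ≤ g τ ω (a, W τ ω))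
    {q : Fin K × Ctx d → ℝ} (hq : Measurable q) (hq0 : ∀ p, 0 ≤ q p) {C : ℝ}
    (hC : ∀ p, q p ≤ C) {s : ℝ} (hs0 : 0 < s)
    (hs : ∫⁻ p, ENNReal.ofReal (q p ^ 2) ∂(refDesignLaw Q) ≤ ENNReal.ofReal (K * δ * s))
    {y : ℝ} (hy : 0 ≤ y) :
    μ {ω | 2 * Real.sqrt (t * s * y) ≤
      ∑ τ ∈ Finset.Icc 1 t, (risk Q κ id q - weightedValue g W A Y q τ ω)} ≤
      ENNReal.ofReal (Real.exp (-y)) := by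
  have htR : (0 : ℝ) < t := by exact_mod_cast ht
  have hts : 0 < t * s := mul_pos htR hs0
  have hθ2 : Real.sqrt (y / (t * s)) ^ 2 = y / (t * s) := Real.sq_sqrt (by positivity)
  -- With `|θ| = √(y / (ts))` the variance term `t θ² s` equals `y`, so the exponent to be reached
  -- is `2y`.
  refine (measure_mono ?_).trans (hb.measure_deviation_ge_le hg0 hg hδ hlower hq hq0 hC hs0.le hs
    (θ := -Real.sqrt (y / (t * s))) (u := 2 * y) ?_ ?_)
  · intro ω hω
    simp only [Set.mem_ofPred_eq] at hω ⊢
    have e : ∑ τ ∈ Finset.Icc 1 t, (weightedValue g W A Y q τ ω - risk Q κ id q) =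
        -∑ τ ∈ Finset.Icc 1 t, (risk Q κ id q - weightedValue g W A Y q τ ω) := by
      rw [← Finset.sum_neg_distrib]; simp
    rw [e, neg_mul_neg]
    calc 2 * y = Real.sqrt (y / (t * s)) * (2 * Real.sqrt (t * s * y)) := by
          have : Real.sqrt (y / (t * s)) * Real.sqrt (t * s * y) = y := by
            rw [← Real.sqrt_mul (by positivity), show y / (t * s) * (t * s * y) = y ^ 2 by
              field_simp]
            exact Real.sqrt_sq hy
          linarith
      _ ≤ _ := by gcongr
  · intro τ hτ
    refine Filter.Eventually.of_forall fun ω => ?_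
    have := mul_nonneg (Real.sqrt_nonneg (y / (t * s)))
      (weightedValue_nonneg (W := W) (A := A) (Y := Y) (hg0 τ hτ ω) hq0)
    linarith
  · rw [neg_sq, hθ2]
    have : t * (y / (t * s) * s) = y := by field_simp
    linarith

theorem IsContextualBandit.measure_upper_deviation_le [IsProbabilityMeasure μ]
    [IsProbabilityMeasure Q] [IsMarkovKernel κ] [NeZero K]
    (hb : IsContextualBandit μ Q κ t g W A Y) (ht : 1 ≤ t)
    (hg0 : ∀ τ ∈ Finset.Icc 1 t, ∀ ω, IsPolicy (g τ ω))
    (hg : ∀ τ ∈ Finset.Icc 1 t, IsMeasurableDesign (history W A Y (τ - 1)) (g τ))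
    {δ : ℝ} (hδ : 0 < δ)
    (hlower : ∀ τ ∈ Finset.Icc 1 t, ∀ᵐ ω ∂μ, ∀ a, δ ≤ g τ ω (a, W τ ω))
    {q : Fin K × Ctx d → ℝ} (hq : Measurable q) (hq0 : ∀ p, 0 ≤ q p) {C : ℝ} (hC0 : 0 < C)
    (hC : ∀ p, q p ≤ C) {s : ℝ} (hs0 : 0 < s)
    (hs : ∫⁻ p, ENNReal.ofReal (q p ^ 2) ∂(refDesignLaw Q) ≤ ENNReal.ofReal (K * δ * s))
    {y : ℝ} (hy : 0 < y) :
    μ {ω | 2 * Real.sqrt (t * s * y) + C * y / (K * δ) ≤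
      ∑ τ ∈ Finset.Icc 1 t, (weightedValue g W A Y q τ ω - risk Q κ id q)} ≤
      ENNReal.ofReal (Real.exp (-y)) := by
  have htR : (0 : ℝ) < t := by exact_mod_cast ht
  have hK : (0 : ℝ) < K := Nat.cast_pos.2 (NeZero.pos K)
  have hts : 0 < t * s := mul_pos htR hs0
  set θ₁ := Real.sqrt (y / (t * s)) with hθ₁
  have hθ₁0 : 0 < θ₁ := Real.sqrt_pos.2 (by positivity)
  have hθ2 : θ₁ ^ 2 = y / (t * s) := Real.sq_sqrt (by positivity)
  have hprod : θ₁ * Real.sqrt (t * s * y) = y := by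
    rw [hθ₁, ← Real.sqrt_mul (by positivity), show y / (t * s) * (t * s * y) = y ^ 2 by
      field_simp]
    exact Real.sqrt_sq hy.le
  -- `θ₁` is the sub-Gaussian choice. The cap ensures `θX ≤ 1`, since `X ≤ C / (Kδ)`; when it is
  -- active, the linear term of the threshold alone contributes `y`.
  set θ := min θ₁ (K * δ / C) with hθ
  have hθ0 : 0 < θ := lt_min hθ₁0 (by positivity)
  refine (measure_mono ?_).trans (hb.measure_deviation_ge_le hg0 hg hδ hlower hq hq0 hC hs0.le hs
    (θ := θ) (u := y + t * (θ ^ 2 * s)) ?_ le_rfl)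
  · intro ω hω
    simp only [Set.mem_ofPred_eq] at hω ⊢
    refine le_trans ?_ (mul_le_mul_of_nonneg_left hω hθ0.le)
    have h1 : t * (θ ^ 2 * s) ≤ θ * Real.sqrt (t * s * y) := by
      have h2 : t * s * θ₁ = Real.sqrt (t * s * y) := by
        have h3 : θ₁ * (t * s * θ₁) = θ₁ * Real.sqrt (t * s * y) := by
          rw [hprod, show θ₁ * (t * s * θ₁) = t * s * θ₁ ^ 2 by ring, hθ2]
          field_simp
        exact mul_left_cancel₀ hθ₁0.ne' h3
      calc t * (θ ^ 2 * s) = θ * (t * s * θ) := by ring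
        _ ≤ θ * (t * s * θ₁) := by
          gcongr
          exact min_le_left _ _
        _ = _ := by rw [h2]
    have h2 : y ≤ θ * (Real.sqrt (t * s * y) + C * y / (K * δ)) := by
      rcases min_choice θ₁ (K * δ / C) with h | h
      · rw [hθ, h, mul_add, hprod]
        have : 0 ≤ θ₁ * (C * y / (K * δ)) := by positivity
        linarith
      · rw [hθ, h, mul_add]
        have h3 : K * δ / C * (C * y / (K * δ)) = y := by field_simp
        have : 0 ≤ K * δ / C * Real.sqrt (t * s * y) := by positivity
        linarith
    linarith
  · intro τ hτ
    filter_upwards [hlower τ hτ] with ω hω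
    have h0 := weightedValue_nonneg (W := W) (A := A) (Y := Y) (hg0 τ hτ ω) hq0
    have h1 := weightedValue_le (A := A) (Y := Y) hδ hω (q := q) (C := C)
      fun p => (abs_of_nonneg (hq0 p)).trans_le (hC p)
    calc θ * weightedValue g W A Y q τ ω ≤ K * δ / C * (C / (K * δ)) :=
          mul_le_mul (min_le_right _ _) h1 h0 (by positivity)
      _ = 1 := by field_simp

end Bandit

/-- The centered sum `∑_τ (R(q) - X_τ(q))` of the weighted values of `q`. -/
noncomputable def deviation {Ω : Type*} {K d : ℕ} (Q : Measure (Ctx d))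
    (κ : Kernel (Fin K × Ctx d) (Fin 2)) (t : ℕ) (g : ℕ → Ω → Fin K × Ctx d → ℝ)
    (W : ℕ → Ω → Ctx d) (A : ℕ → Ω → Fin K) (Y : ℕ → Ω → Fin 2) (q : Fin K × Ctx d → ℝ)
    (ω : Ω) : ℝ :=
  ∑ τ ∈ Finset.Icc 1 t, (risk Q κ id q - weightedValue g W A Y q τ ω)

/-! ### Linearity of the centered sum -/

section Linear

variable {Ω : Type*} {K d : ℕ} {Q : Measure (Ctx d)} {κ : Kernel (Fin K × Ctx d) (Fin 2)} {t : ℕ}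
  {g : ℕ → Ω → Fin K × Ctx d → ℝ} {W : ℕ → Ω → Ctx d} {A : ℕ → Ω → Fin K} {Y : ℕ → Ω → Fin 2}

theorem loss_id_add (q q' : Fin K × Ctx d → ℝ) (w : Ctx d) (a : Fin K) (y : Fin 2) :
    loss id (q + q') w a y = loss id q w a y + loss id q' w a y := by
  simp [loss, add_mul]

theorem weightedValue_add (q q' : Fin K × Ctx d → ℝ) (τ : ℕ) (ω : Ω) :
    weightedValue g W A Y (q + q') τ ω =
      weightedValue g W A Y q τ ω + weightedValue g W A Y q' τ ω := by
  simp [weightedValue, isLoss, loss_id_add, mul_add]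

theorem risk_id_add [IsProbabilityMeasure Q] [IsMarkovKernel κ] [NeZero K]
    {q q' : Fin K × Ctx d → ℝ} (hq : Measurable q) (hq' : Measurable q') {C C' : ℝ}
    (hC : ∀ p, |q p| ≤ C) (hC' : ∀ p, |q' p| ≤ C') :
    risk Q κ id (q + q') = risk Q κ id q + risk Q κ id q' := by
  unfold risk
  simp_rw [loss_id_add]
  exact integral_add (integrable_loss_id Q κ hq hC) (integrable_loss_id Q κ hq' hC')

theorem deviation_add [IsProbabilityMeasure Q] [IsMarkovKernel κ] [NeZero K]
    {q q' : Fin K × Ctx d → ℝ} (hq : Measurable q) (hq' : Measurable q') {C C' : ℝ}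
    (hC : ∀ p, |q p| ≤ C) (hC' : ∀ p, |q' p| ≤ C') (ω : Ω) :
    deviation Q κ t g W A Y (q + q') ω =
      deviation Q κ t g W A Y q ω + deviation Q κ t g W A Y q' ω := by
  unfold deviation
  rw [← Finset.sum_add_distrib]
  refine Finset.sum_congr rfl fun τ _ => ?_
  rw [risk_id_add hq hq' hC hC', weightedValue_add]
  ring

theorem deviation_neg (q : Fin K × Ctx d → ℝ) (ω : Ω) :
    deviation Q κ t g W A Y (-q) ω =
      ∑ τ ∈ Finset.Icc 1 t, (weightedValue g W A Y q τ ω - risk Q κ id q) := by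
  unfold deviation
  refine Finset.sum_congr rfl fun τ _ => ?_
  have h1 : risk Q κ id (-q) = -risk Q κ id q := by
    simp [risk, loss, integral_neg]
  have h2 : weightedValue g W A Y (-q) τ ω = -weightedValue g W A Y q τ ω := by
    simp [weightedValue, isLoss, loss]
  rw [h1, h2]
  ring

end Linear

/-! ### Increasing chains of lower brackets -/

section Chain

variable {X : Type*}

/-- The running maxima of `c` and `b 0, b 1, …`. -/
def lowerChain (c : X → ℝ) (b : ℕ → X → ℝ) : ℕ → X → ℝ
  | 0 => c
  | n + 1 => lowerChain c b n ⊔ b n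

theorem lowerChain_le {c h : X → ℝ} {b : ℕ → X → ℝ} {n : ℕ} (hc : c ≤ h)
    (hb : ∀ k < n, b k ≤ h) : lowerChain c b n ≤ h := by
  induction n with
  | zero => exact hc
  | succ n ih =>
    exact sup_le (ih fun k hk => hb k (hk.trans (Nat.lt_succ_self n))) (hb n (Nat.lt_succ_self n))

theorem le_lowerChain (c : X → ℝ) (b : ℕ → X → ℝ) (n : ℕ) : c ≤ lowerChain c b n := by
  induction n with
  | zero => exact le_rfl
  | succ n ih => exact ih.trans le_sup_left

theorem measurable_lowerChain [MeasurableSpace X] {c : X → ℝ} {b : ℕ → X → ℝ} {n : ℕ}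
    (hc : Measurable c) (hb : ∀ k < n, Measurable (b k)) : Measurable (lowerChain c b n) := by
  induction n with
  | zero => exact hc
  | succ n ih =>
    exact (ih fun k hk => hb k (hk.trans (Nat.lt_succ_self n))).sup (hb n (Nat.lt_succ_self n))

open Classical in
/-- The possible values of the `n`-th running maximum, the brackets being taken from `S`. -/
noncomputable def chainValues (c : X → ℝ) (S : ℕ → Finset ((X → ℝ) × (X → ℝ))) : ℕ → Finset (X → ℝ)
  | 0 => {c}
  | n + 1 => Finset.image₂ (fun f b => f ⊔ b.1) (chainValues c S n) (S n)

open Classical in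
/-- The possible values of the `n`-th increment of the running maximum. -/
noncomputable def chainIncrements (c : X → ℝ) (S : ℕ → Finset ((X → ℝ) × (X → ℝ))) (n : ℕ) :
    Finset (X → ℝ) :=
  Finset.image₂ (fun f b => f ⊔ b.1 - f) (chainValues c S n) (S n)

theorem card_chainValues_le (c : X → ℝ) (S : ℕ → Finset ((X → ℝ) × (X → ℝ))) (n : ℕ) :
    (chainValues c S n).card ≤ ∏ k ∈ Finset.range n, (S k).card := by
  classical
  induction n with
  | zero => simp [chainValues]
  | succ n ih =>
    rw [Finset.prod_range_succ]
    exact (Finset.card_image₂_le _ _ _).trans (Nat.mul_le_mul_right _ ih)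

theorem card_chainIncrements_le (c : X → ℝ) (S : ℕ → Finset ((X → ℝ) × (X → ℝ))) (n : ℕ) :
    (chainIncrements c S n).card ≤ ∏ k ∈ Finset.range (n + 1), (S k).card := by
  classical
  rw [Finset.prod_range_succ]
  exact (Finset.card_image₂_le _ _ _).trans (Nat.mul_le_mul_right _ (card_chainValues_le c S n))

theorem lowerChain_mem_chainValues {c : X → ℝ} {S : ℕ → Finset ((X → ℝ) × (X → ℝ))}
    {β : ℕ → (X → ℝ) × (X → ℝ)} {n : ℕ} (hβ : ∀ k < n, β k ∈ S k) :
    lowerChain c (fun k => (β k).1) n ∈ chainValues c S n := by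
  classical
  induction n with
  | zero => simp [chainValues, lowerChain]
  | succ n ih =>
    exact Finset.mem_image₂.2 ⟨_, ih fun k hk => hβ k (hk.trans (Nat.lt_succ_self n)), β n,
      hβ n (Nat.lt_succ_self n), rfl⟩

theorem sub_lowerChain_mem_chainIncrements {c : X → ℝ} {S : ℕ → Finset ((X → ℝ) × (X → ℝ))}
    {β : ℕ → (X → ℝ) × (X → ℝ)} {n : ℕ} (hβ : ∀ k < n + 1, β k ∈ S k) :
    lowerChain c (fun k => (β k).1) (n + 1) - lowerChain c (fun k => (β k).1) n ∈
      chainIncrements c S n := by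
  classical
  exact Finset.mem_image₂.2 ⟨_, lowerChain_mem_chainValues fun k hk =>
    hβ k (hk.trans (Nat.lt_succ_self n)), β n, hβ n (Nat.lt_succ_self n), rfl⟩

end Chain

/-! ### Brackets and the chaining bound -/

theorem lintegral_ofReal_sq_le_of_eLpNorm_le {X : Type*} [MeasurableSpace X] {P : Measure X}
    {f : X → ℝ} {ε : ℝ} (hf : eLpNorm f 2 P ≤ ENNReal.ofReal ε) :
    ∫⁻ p, ENNReal.ofReal (f p ^ 2) ∂P ≤ ENNReal.ofReal (ε ^ 2) := by
  have h : eLpNorm f 2 P ^ 2 = ∫⁻ p, ENNReal.ofReal (f p ^ 2) ∂P := by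
    rw [eLpNorm_eq_lintegral_rpow_enorm_toReal (by norm_num) (by norm_num), ← ENNReal.rpow_natCast,
      ← ENNReal.rpow_mul]
    norm_num
    refine lintegral_congr fun p => ?_
    rw [← sq_abs, ENNReal.ofReal_pow (abs_nonneg _), Real.enorm_eq_ofReal_abs]
  rw [← h]
  rcases le_total 0 ε with hε | hε
  · rw [ENNReal.ofReal_pow hε]
    gcongr
  · rw [ENNReal.ofReal_of_nonpos hε] at hf
    simp [le_antisymm hf zero_le]

theorem lintegral_ofReal_le_of_eLpNorm_two_le {X : Type*} [MeasurableSpace X] {P : Measure X}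
    [IsProbabilityMeasure P] {f : X → ℝ} (hfm : Measurable f) {ε : ℝ}
    (hf : eLpNorm f 2 P ≤ ENNReal.ofReal ε) :
    ∫⁻ p, ENNReal.ofReal (f p) ∂P ≤ ENNReal.ofReal ε := by
  calc ∫⁻ p, ENNReal.ofReal (f p) ∂P ≤ ∫⁻ p, ‖f p‖ₑ ∂P :=
        lintegral_mono fun p => Real.ofReal_le_enorm _
    _ = eLpNorm f 1 P := eLpNorm_one_eq_lintegral_enorm.symm
    _ ≤ eLpNorm f 2 P := eLpNorm_le_eLpNorm_of_exponent_le (by norm_num) hfm.aestronglyMeasurable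
    _ ≤ _ := hf

open Classical in
theorem IsBracketing.comp {X : Type*} [MeasurableSpace X] {ε : ℝ} {F : Set (X → ℝ)}
    {r : ℝ≥0∞} {P : Measure X} {S : Finset ((X → ℝ) × (X → ℝ))} (hS : IsBracketing ε F r P S)
    {φ : ℝ → ℝ} (hφ : Monotone φ) (hL : LipschitzWith 1 φ) :
    IsBracketing ε ((fun f => φ ∘ f) '' F) r P (S.image fun b => (φ ∘ b.1, φ ∘ b.2)) := by
  refine ⟨fun b hb => ?_, ?_⟩
  · obtain ⟨b', hb', rfl⟩ := Finset.mem_image.1 hb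
    obtain ⟨h1, h2, h3⟩ := hS.1 b' hb'
    refine ⟨hφ.measurable.comp h1, hφ.measurable.comp h2, (eLpNorm_mono fun p => ?_).trans h3⟩
    simpa [Real.dist_eq] using hL.dist_le_mul (b'.2 p) (b'.1 p)
  · rintro _ ⟨f, hf, rfl⟩
    obtain ⟨b, hb, hbf⟩ := hS.2 f hf
    exact ⟨_, Finset.mem_image_of_mem _ hb, fun p => ⟨hφ (hbf p).1, hφ (hbf p).2⟩⟩

/-- Chaining along increasing running maxima of lower brackets, so that every link is nonnegative
and has a sub-Gaussian bound. The exceptional set `N` is the union of finitely many events that do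
not depend on `h`; this makes the bound uniform over `H`. -/
theorem IsContextualBandit.exists_deviation_bound {Ω : Type*} [MeasurableSpace Ω] {K d : ℕ}
    {μ : Measure Ω} {Q : Measure (Ctx d)} {κ : Kernel (Fin K × Ctx d) (Fin 2)} {t : ℕ}
    {g : ℕ → Ω → Fin K × Ctx d → ℝ} {W : ℕ → Ω → Ctx d} {A : ℕ → Ω → Fin K}
    {Y : ℕ → Ω → Fin 2} [IsProbabilityMeasure μ]
    [IsProbabilityMeasure Q] [IsMarkovKernel κ] [NeZero K]
    (hb : IsContextualBandit μ Q κ t g W A Y) (ht : 1 ≤ t)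
    (hg0 : ∀ τ ∈ Finset.Icc 1 t, ∀ ω, IsPolicy (g τ ω))
    (hg : ∀ τ ∈ Finset.Icc 1 t, IsMeasurableDesign (history W A Y (τ - 1)) (g τ))
    {δ : ℝ} (hδ : 0 < δ)
    (hlower : ∀ τ ∈ Finset.Icc 1 t, ∀ᵐ ω ∂μ, ∀ a, δ ≤ g τ ω (a, W τ ω))
    {H : Set (Fin K × Ctx d → ℝ)} (hHm : ∀ h ∈ H, Measurable h) {h₀ : Fin K × Ctx d → ℝ}
    (hh₀ : h₀ ∈ H) {B : ℝ} (hB : 0 < B) (hHB : ∀ h ∈ H, ∀ p, |h p - h₀ p| ≤ B)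
    {J : ℕ} {S : ℕ → Finset ((Fin K × Ctx d → ℝ) × (Fin K × Ctx d → ℝ))} {ε e y : ℕ → ℝ}
    (hS : ∀ n ≤ J, IsBracketing (ε n) H 2 (refDesignLaw Q) (S n))
    (he₀ : e 0 = 2 * B) (he : ∀ n < J, e (n + 1) = ε n) (hε : ∀ n ≤ J, 0 < ε n)
    (hy : ∀ n ≤ J, 0 ≤ y n) {x : ℝ} (hx : 0 < x) :
    ∃ N : Set Ω, μ N ≤ ENNReal.ofReal (Real.exp (-x)) + ∑ n ∈ Finset.range (J + 1),
        ((∏ k ∈ Finset.range (n + 1), (S k).card : ℕ) : ℝ≥0∞) *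
          ENNReal.ofReal (Real.exp (-y n)) ∧
      ∀ ω ∉ N, ∀ h ∈ H, deviation Q κ t g W A Y (h - h₀) ω < t * ε J +
        ∑ n ∈ Finset.range (J + 1), 2 * Real.sqrt (t * (e n ^ 2 / (K * δ)) * y n) +
        (2 * Real.sqrt (t * (B ^ 2 / (K * δ)) * x) + B * x / (K * δ)) := by
  classical
  have hK : (0 : ℝ) < K := Nat.cast_pos.2 (NeZero.pos K)
  have hKδ : 0 < K * δ := mul_pos hK hδ
  have hcancel (r : ℝ) : K * δ * (r / (K * δ)) = r := by field_simp
  have hepos : ∀ n ≤ J, 0 < e n := by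
    rintro (_ | n) hn
    · rw [he₀]; positivity
    · rw [he n hn]; exact hε n (Nat.le_of_succ_le hn)
  -- Every `h ∈ H` lies between `h₀ - B` and `h₀ + B`: this start is common to all chains and makes
  -- the first link nonnegative and at most `2B = e 0`.
  set c : Fin K × Ctx d → ℝ := fun p => h₀ p - B with hc
  have hcm : Measurable c := (hHm h₀ hh₀).sub_const B
  -- `chainIncrements` also contains combinations of brackets that belong to no common `h`, whose
  -- norm is not controlled. The union bound keeps only those with the required moment.
  set good : ℕ → (Fin K × Ctx d → ℝ) → Prop := fun n q =>
    Measurable q ∧ (∀ p, 0 ≤ q p) ∧ (∀ p, q p ≤ 2 * B) ∧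
      ∫⁻ p, ENNReal.ofReal (q p ^ 2) ∂(refDesignLaw Q) ≤ ENNReal.ofReal (e n ^ 2)
  set E : ℕ → (Fin K × Ctx d → ℝ) → Set Ω := fun n q =>
    {ω | 2 * Real.sqrt (t * (e n ^ 2 / (K * δ)) * y n) ≤ deviation Q κ t g W A Y q ω}
  set E₀ : Set Ω := {ω | 2 * Real.sqrt (t * (B ^ 2 / (K * δ)) * x) + B * x / (K * δ) ≤
    ∑ τ ∈ Finset.Icc 1 t, (weightedValue g W A Y (fun _ => B) τ ω -
      risk Q κ id fun _ => B)}
  have hμE₀ : μ E₀ ≤ ENNReal.ofReal (Real.exp (-x)) := by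
    refine hb.measure_upper_deviation_le ht hg0 hg hδ hlower measurable_const (fun _ => hB.le) hB
      (fun _ => le_rfl) (by positivity) ?_ hx
    rw [hcancel]
    simp
  have hμE : ∀ n ≤ J, ∀ q, good n q → μ (E n q) ≤ ENNReal.ofReal (Real.exp (-y n)) := by
    rintro n hn q ⟨hq1, hq2, hq3, hq4⟩
    refine hb.measure_lower_deviation_le ht hg0 hg hδ hlower hq1 hq2 hq3
      (div_pos (pow_pos (hepos n hn) 2) hKδ) ?_ (hy n hn)
    rwa [hcancel]
  refine ⟨E₀ ∪ ⋃ n ∈ Finset.range (J + 1), ⋃ q ∈ (chainIncrements c S n).filter (good n), E n q,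
    ?_, ?_⟩
  · refine (measure_union_le _ _).trans (add_le_add hμE₀ ?_)
    refine (measure_biUnion_finset_le _ _).trans (Finset.sum_le_sum fun n hn => ?_)
    have hn' : n ≤ J := Nat.lt_succ_iff.1 (Finset.mem_range.1 hn)
    calc _ ≤ ∑ q ∈ (chainIncrements c S n).filter (good n), μ (E n q) :=
          measure_biUnion_finset_le _ _
      _ ≤ ∑ q ∈ (chainIncrements c S n).filter (good n), ENNReal.ofReal (Real.exp (-y n)) :=
          Finset.sum_le_sum fun q hq => hμE n hn' q (Finset.mem_filter.1 hq).2
      _ ≤ _ := by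
          rw [Finset.sum_const, nsmul_eq_mul]
          gcongr
          exact (Finset.card_filter_le _ _).trans (card_chainIncrements_le c S n)
  · intro ω hω h hh
    have hω₀ : ω ∉ E₀ := fun h' => hω (Or.inl h')
    have hωE : ∀ n ≤ J, ∀ q ∈ chainIncrements c S n, good n q →
        deviation Q κ t g W A Y q ω < 2 * Real.sqrt (t * (e n ^ 2 / (K * δ)) * y n) := by
      intro n hn q hq hqg
      by_contra hcon
      refine hω (Or.inr (Set.mem_biUnion (Finset.mem_coe.2
        (Finset.mem_range.2 (Nat.lt_succ_of_le hn))) (Set.mem_biUnion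
          (Finset.mem_coe.2 (Finset.mem_filter.2 ⟨hq, hqg⟩)) ?_)))
      exact not_lt.1 hcon
    have hex : ∀ n, ∃ b, n ≤ J → b ∈ S n ∧ ∀ p, b.1 p ≤ h p ∧ h p ≤ b.2 p := fun n => by
      by_cases hn : n ≤ J
      · obtain ⟨b, hb1, hb2⟩ := (hS n hn).2 h hh
        exact ⟨b, fun _ => ⟨hb1, hb2⟩⟩
      · exact ⟨(0, 0), fun h => absurd h hn⟩
    choose β hβ using hex
    set L := lowerChain c fun k => (β k).1
    have hch : c ≤ h := fun p => by
      have := (abs_le.1 (hHB h hh p)).1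
      simp only [hc]
      linarith
    have hLh : ∀ n ≤ J + 1, L n ≤ h := fun n hn =>
      lowerChain_le hch fun k hk p => ((hβ k (Nat.lt_succ_iff.1 (hk.trans_le hn))).2 p).1
    have hcL : ∀ n, c ≤ L n := fun n => le_lowerChain c _ n
    have hLm : ∀ n ≤ J + 1, Measurable (L n) := fun n hn =>
      measurable_lowerChain hcm fun k hk =>
        ((hS k (Nat.lt_succ_iff.1 (hk.trans_le hn))).1 _
          (hβ k (Nat.lt_succ_iff.1 (hk.trans_le hn))).1).1
    have hhc : ∀ p, h p - c p ≤ 2 * B := fun p => by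
      have := (abs_le.1 (hHB h hh p)).2
      simp only [hc]
      linarith
    have hgap : ∀ n ≤ J, ∀ p, h p - L (n + 1) p ≤ (β n).2 p - (β n).1 p := fun n hn p => by
      have h1 : (β n).1 p ≤ L (n + 1) p := le_sup_right (a := L n p)
      have h2 := ((hβ n hn).2 p).2
      linarith
    -- The link at level `n + 1` is at most `h` minus the preceding maximum, hence at most the width
    -- of the bracket at level `n`: this is why `e (n + 1) = ε n`.
    have hinc : ∀ n ≤ J, good n (L (n + 1) - L n) := by
      intro n hn
      have hnonneg : ∀ p, 0 ≤ (L (n + 1) - L n) p := fun p =>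
        sub_nonneg.2 (le_sup_left (a := L n p))
      have hle : ∀ p, (L (n + 1) - L n) p ≤ h p - L n p := fun p =>
        sub_le_sub_right (hLh (n + 1) (Nat.succ_le_succ hn) p) _
      have hle2 : ∀ p, (L (n + 1) - L n) p ≤ 2 * B := fun p =>
        (hle p).trans ((sub_le_sub_left (hcL n p) _).trans (hhc p))
      refine ⟨(hLm _ (Nat.succ_le_succ hn)).sub (hLm _ (hn.trans (Nat.le_succ J))), hnonneg,
        hle2, ?_⟩
      cases n with
      | zero =>
        calc _ ≤ ∫⁻ _, ENNReal.ofReal (e 0 ^ 2) ∂(refDesignLaw Q) := by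
              refine lintegral_mono fun p => ENNReal.ofReal_le_ofReal ?_
              rw [he₀]
              exact pow_le_pow_left₀ (hnonneg p) (hle2 p) 2
          _ = _ := by simp
      | succ n =>
        rw [he n hn]
        refine le_trans ?_ (lintegral_ofReal_sq_le_of_eLpNorm_le
          ((hS n (Nat.le_of_succ_le hn)).1 _ (hβ n (Nat.le_of_succ_le hn)).1).2.2)
        exact lintegral_mono fun p => ENNReal.ofReal_le_ofReal (pow_le_pow_left₀ (hnonneg p)
          ((hle p).trans (hgap n (Nat.le_of_succ_le hn) p)) 2)
    have hchain : ∀ n ≤ J + 1, deviation Q κ t g W A Y (L n - c) ω ≤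
        ∑ k ∈ Finset.range n, 2 * Real.sqrt (t * (e k ^ 2 / (K * δ)) * y k) := by
      intro n
      induction n with
      | zero =>
        intro _
        have : L 0 - c = 0 := sub_self c
        rw [this]
        simp [deviation, risk, weightedValue, isLoss, loss]
      | succ n ih =>
        intro hn
        have hn' : n ≤ J := Nat.succ_le_succ_iff.1 hn
        have hg1 := hinc n hn'
        have hdec : L (n + 1) - c = (L n - c) + (L (n + 1) - L n) := by abel
        rw [hdec, deviation_add ((hLm n (hn'.trans (Nat.le_succ J))).sub hcm) hg1.1
          (C := 2 * B) (C' := 2 * B) (fun p => ?_)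
          (fun p => (abs_of_nonneg (hg1.2.1 p)).trans_le (hg1.2.2.1 p)), Finset.sum_range_succ]
        · exact add_le_add (ih (Nat.le_of_succ_le hn)) (hωE n hn' _
            (sub_lowerChain_mem_chainIncrements fun k hk =>
              (hβ k ((Nat.lt_succ_iff.1 hk).trans hn')).1) hg1).le
        · rw [Pi.sub_apply, abs_of_nonneg (sub_nonneg.2 (hcL n p))]
          have := hLh n (hn'.trans (Nat.le_succ J)) p
          linarith [hhc p]
    have hrem0 : ∀ p, 0 ≤ (h - L (J + 1)) p := fun p => sub_nonneg.2 (hLh _ le_rfl p)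
    have hremB : ∀ p, (h - L (J + 1)) p ≤ 2 * B := fun p =>
      (sub_le_sub_left (hcL _ p) _).trans (hhc p)
    have hremm : Measurable (h - L (J + 1)) := (hHm h hh).sub (hLm _ le_rfl)
    have hrisk : risk Q κ id (h - L (J + 1)) ≤ ε J := by
      rw [← ENNReal.ofReal_le_ofReal_iff (hε J le_rfl).le, ofReal_risk_id Q κ hremm hrem0 hremB]
      obtain ⟨hβ1, hβ2, hβ3⟩ := (hS J le_rfl).1 _ (hβ J le_rfl).1
      refine le_trans ?_ (lintegral_ofReal_le_of_eLpNorm_two_le (hβ2.sub hβ1) hβ3)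
      refine lintegral_mono fun p => ?_
      calc _ ≤ ENNReal.ofReal ((h - L (J + 1)) p) * 1 := by
            gcongr
            exact ENNReal.ofReal_le_one.2 measureReal_le_one
        _ ≤ _ := by
            rw [mul_one]
            exact ENNReal.ofReal_le_ofReal (hgap J le_rfl p)
    have hrem : deviation Q κ t g W A Y (h - L (J + 1)) ω ≤ t * ε J := by
      calc _ ≤ ∑ τ ∈ Finset.Icc 1 t, ε J := by
            -- The remainder is nonnegative, so its weighted values can be dropped and only its risk
            -- counts.
            refine Finset.sum_le_sum fun τ hτ => ?_
            have := weightedValue_nonneg (W := W) (A := A) (Y := Y) (hg0 τ hτ ω) hrem0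
            linarith
        _ = _ := by simp
    have hconst : deviation Q κ t g W A Y (-fun _ => B) ω <
        2 * Real.sqrt (t * (B ^ 2 / (K * δ)) * x) + B * x / (K * δ) := by
      rw [deviation_neg]
      exact not_le.1 hω₀
    have hLcm : Measurable (L (J + 1) - c) := (hLm _ le_rfl).sub hcm
    have hLcB : ∀ p, |(L (J + 1) - c) p| ≤ 2 * B := fun p => by
      rw [Pi.sub_apply, abs_of_nonneg (sub_nonneg.2 (hcL _ p))]
      have := hLh _ le_rfl p
      linarith [hhc p]
    have hneg : ∀ p : Fin K × Ctx d, |(-fun _ => B : Fin K × Ctx d → ℝ) p| ≤ B := fun p => by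
      simp [abs_of_pos hB]
    -- Remainder, chain, and the constant `c - h₀ = -B`.
    have hdec : h - h₀ = (h - L (J + 1)) + (L (J + 1) - c) + (-fun _ => B) := by
      funext p
      simp only [hc, Pi.add_apply, Pi.sub_apply, Pi.neg_apply]
      ring
    rw [hdec, deviation_add (hremm.add hLcm) measurable_const.neg (C := 4 * B) (C' := B)
      (fun p => ?_) hneg, deviation_add hremm hLcm
        (fun p => (abs_of_nonneg (hrem0 p)).trans_le (hremB p)) hLcB]
    · exact add_lt_add_of_le_of_lt (add_le_add hrem (hchain _ le_rfl)) hconst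
    · have h1 := (abs_of_nonneg (hrem0 p)).trans_le (hremB p)
      calc _ ≤ |(h - L (J + 1)) p| + |(L (J + 1) - c) p| := abs_add_le _ _
        _ ≤ _ := by linarith [hLcB p]

/-! ### Entropy numbers, dyadic sums and the union bound -/

theorem exists_isBracketing_of_bracketingNumber_ne_top {X : Type*} [MeasurableSpace X] {ε : ℝ}
    {F : Set (X → ℝ)} {r : ℝ≥0∞} {P : Measure X} (h : bracketingNumber ε F r P ≠ ⊤) :
    ∃ S, IsBracketing ε F r P S ∧ (S.card : ℕ∞) = bracketingNumber ε F r P := by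
  have hne : Nonempty {S // IsBracketing ε F r P S} := by
    by_contra hcon
    rw [nonempty_subtype, not_exists] at hcon
    exact h (by simp [bracketingNumber, hcon])
  have e : bracketingNumber ε F r P =
      ⨅ S : {S // IsBracketing ε F r P S}, (S.1.card : ℕ∞) := by
    rw [bracketingNumber, iInf_subtype]
  obtain ⟨S, hS⟩ := ciInf_mem fun S : {S // IsBracketing ε F r P S} =>
    (S.1.card : ℕ∞)
  exact ⟨S, S.2, hS.trans e.symm⟩

theorem bracketingNumber_antitone {X : Type*} [MeasurableSpace X] (F : Set (X → ℝ)) (r : ℝ≥0∞)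
    (P : Measure X) : Antitone fun ε => bracketingNumber ε F r P := by
  intro ε₁ ε₂ h
  refine le_iInf₂ fun S hS => iInf₂_le S ⟨fun b hb => ?_, hS.2⟩
  obtain ⟨h1, h2, h3⟩ := hS.1 b hb
  exact ⟨h1, h2, h3.trans (ENNReal.ofReal_le_ofReal h)⟩

theorem sqrtLogOneAdd_mono : Monotone sqrtLogOneAdd := by
  intro m n h
  by_cases hn : n = ⊤
  · simp [sqrtLogOneAdd, hn]
  have hm : m ≠ ⊤ := ne_top_of_le_ne_top hn h
  simp only [sqrtLogOneAdd, hn, hm, if_false]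
  have : (m.toNat : ℝ) ≤ n.toNat := Nat.cast_le.2 (ENat.toNat_le_toNat h hn)
  gcongr

/-- Dyadic Riemann sums bound the integral of a decreasing function from below. -/
theorem sum_dyadic_le_lintegral {ψ : ℝ → ℝ≥0∞} (hψ : Antitone ψ) {ε₀ B : ℝ} (hε₀ : 0 ≤ ε₀)
    (hB : ε₀ ≤ B) (J : ℕ) :
    ∑ k ∈ Finset.range (J + 1), ENNReal.ofReal (ε₀ / 2 ^ k / 2) * ψ (ε₀ / 2 ^ k) ≤
      ∫⁻ ε in Set.Icc (ε₀ / 2 ^ J / 2) B, ψ ε := by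
  set f : ℕ → ℝ := fun k => ε₀ / 2 ^ k with hf
  have hsucc : ∀ k, f (k + 1) = f k / 2 := fun k => by simp only [hf, pow_succ]; field_simp
  have hanti : Antitone f := antitone_nat_of_succ_le fun k => by
    rw [hsucc]
    have : 0 ≤ f k := by simp only [hf]; positivity
    linarith
  have hdisj : (↑(Finset.range (J + 1)) : Set ℕ).PairwiseDisjoint
      fun k => Set.Ioc (f (k + 1)) (f k) := fun i _ j _ hij =>
    hanti.pairwise_disjoint_on_Ioc_succ hij
  calc _ ≤ ∑ k ∈ Finset.range (J + 1), ∫⁻ ε in Set.Ioc (f (k + 1)) (f k), ψ ε := by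
        refine Finset.sum_le_sum fun k _ => ?_
        -- The dyadic interval ending at `f k` has length `f k / 2`, and `ψ` is smallest at its
        -- right end. The last interval begins at half the finest scale, hence the lower limit of
        -- the integral.
        calc _ = ∫⁻ _ in Set.Ioc (f (k + 1)) (f k), ψ (f k) := by
              rw [setLIntegral_const, Real.volume_Ioc, hsucc, sub_half, mul_comm]
          _ ≤ _ := setLIntegral_mono' measurableSet_Ioc fun ε hε => hψ hε.2
    _ = ∫⁻ ε in ⋃ k ∈ Finset.range (J + 1), Set.Ioc (f (k + 1)) (f k), ψ ε :=
        (lintegral_biUnion_finset hdisj (fun _ _ => measurableSet_Ioc) _).symm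
    _ ≤ _ := by
        refine lintegral_mono_set (Set.iUnion₂_subset fun k hk ε hε => ⟨?_, ?_⟩)
        · have : f (J + 1) ≤ f (k + 1) := hanti (Finset.mem_range.1 hk)
          rw [hsucc] at this
          exact this.trans hε.1.le
        · refine hε.2.trans ((hanti (Nat.zero_le k)).trans ?_)
          simpa [hf] using hB

/-- Summation by parts: `l k` is counted with the geometric tail `∑_{n ≥ k} c / 2^n = 2 c / 2^k`.
The second term on the left is the part of the tails beyond `m`. -/
theorem sum_dyadic_mul_sum (c D : ℝ) (l : ℕ → ℝ) (m : ℕ) :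
    ∑ n ∈ Finset.range m, c / 2 ^ n * (D + ∑ k ∈ Finset.range (n + 1), l k) +
        2 * (c / 2 ^ m) * (D + ∑ k ∈ Finset.range m, l k) =
      2 * c * D + 2 * ∑ k ∈ Finset.range m, c / 2 ^ k * l k := by
  induction m with
  | zero => simp
  | succ m ih =>
    rw [Finset.sum_range_succ, Finset.sum_range_succ _ m,
      Finset.sum_range_succ (fun k => c / 2 ^ k * l k), pow_succ]
    linear_combination ih

theorem sqrt_add_le_add_sqrt {a b : ℝ} (ha : 0 ≤ a) (hb : 0 ≤ b) :
    Real.sqrt (a + b) ≤ Real.sqrt a + Real.sqrt b := by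
  refine Real.sqrt_le_iff.2 ⟨by positivity, ?_⟩
  rw [add_sq, Real.sq_sqrt ha, Real.sq_sqrt hb]
  have : 0 ≤ 2 * Real.sqrt a * Real.sqrt b := by positivity
  linarith

theorem sqrt_sum_le_sum_sqrt {ι : Type*} (s : Finset ι) {f : ι → ℝ} (hf : ∀ i ∈ s, 0 ≤ f i) :
    Real.sqrt (∑ i ∈ s, f i) ≤ ∑ i ∈ s, Real.sqrt (f i) := by
  refine Finset.le_sum_of_subadditive_on_pred Real.sqrt (fun a => 0 ≤ a) Real.sqrt_zero.le
    (fun a b => sqrt_add_le_add_sqrt) (fun a b => add_nonneg) f hf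

/-- It follows from `2N ≤ (1 + N)²`. The constant is relaxed from `2` to `2 ^ 2` so that its square
root is exact. -/
theorem log_two_mul_le {N : ℕ} (hN : 1 ≤ N) :
    Real.log (2 * N) ≤ 2 ^ 2 * Real.log (1 + N) := by
  have hN' : (1 : ℝ) ≤ N := by exact_mod_cast hN
  have h0 : 0 ≤ Real.log (1 + N) := Real.log_nonneg (by linarith)
  have h1 : Real.log (2 * N) ≤ Real.log ((1 + N) ^ 2) :=
    Real.log_le_log (by positivity) (by nlinarith)
  rw [Real.log_pow] at h1
  push_cast at h1
  linarith

/-- Each term splits by subadditivity of the square root into a part from `x` and parts from the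
levels `k ≤ n`. Summation by parts doubles both: `8 · 2 = 16` in front of `B √x`, and `8 · 2 · 4 =
64` in front of `I`, where `4` combines `l k = 2 √log` with the half lengths of the dyadic
intervals. -/
theorem chaining_sum_le {t M x B ε₀ I : ℝ} (ht : 0 < t) (hM : 0 < M) (hx : 0 ≤ x)
    (hε₀ : 0 ≤ ε₀) (hε₀B : ε₀ ≤ B) {J : ℕ} {N : ℕ → ℕ}
    (hN : ∀ k ≤ J, 1 ≤ N k) {e : ℕ → ℝ} (he0 : ∀ n ≤ J, 0 ≤ e n)
    (he : ∀ n ≤ J, e n ≤ 4 * (ε₀ / 2 ^ n))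
    (hI : ∑ k ∈ Finset.range (J + 1), ε₀ / 2 ^ k / 2 * Real.sqrt (Real.log (1 + N k)) ≤ I) :
    ∑ n ∈ Finset.range (J + 1), 2 * Real.sqrt (t * (e n ^ 2 / M) *
        (x + ∑ k ∈ Finset.range (n + 1), Real.log (2 * N k))) ≤
      Real.sqrt (t / M) * (16 * B * Real.sqrt x + 64 * I) := by
  set l : ℕ → ℝ := fun k => 2 * Real.sqrt (Real.log (1 + N k)) with hl
  have hl0 : ∀ k, 0 ≤ l k := fun k => by simp only [hl]; positivity
  have hterm : ∀ n ∈ Finset.range (J + 1), 2 * Real.sqrt (t * (e n ^ 2 / M) *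
        (x + ∑ k ∈ Finset.range (n + 1), Real.log (2 * N k))) ≤
      8 * Real.sqrt (t / M) *
        (ε₀ / 2 ^ n * (Real.sqrt x + ∑ k ∈ Finset.range (n + 1), l k)) := by
    intro n hn
    have hn' : n ≤ J := Nat.lt_succ_iff.1 (Finset.mem_range.1 hn)
    have hkJ : ∀ k ∈ Finset.range (n + 1), k ≤ J := fun k hk =>
      (Nat.lt_succ_iff.1 (Finset.mem_range.1 hk)).trans hn'
    have hlog0 : ∀ k ∈ Finset.range (n + 1), 0 ≤ Real.log (2 * N k) := fun k hk => by
      have : (1 : ℝ) ≤ N k := by exact_mod_cast hN k (hkJ k hk)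
      exact Real.log_nonneg (by linarith)
    have h1 : Real.sqrt (x + ∑ k ∈ Finset.range (n + 1), Real.log (2 * N k)) ≤
        Real.sqrt x + ∑ k ∈ Finset.range (n + 1), l k := by
      refine (sqrt_add_le_add_sqrt hx (Finset.sum_nonneg hlog0)).trans (add_le_add le_rfl
        ((sqrt_sum_le_sum_sqrt _ hlog0).trans (Finset.sum_le_sum fun k hk => ?_)))
      refine (Real.sqrt_le_sqrt (log_two_mul_le (hN k (hkJ k hk)))).trans_eq ?_
      rw [Real.sqrt_mul (by norm_num), Real.sqrt_sq (by norm_num)]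
    rw [show t * (e n ^ 2 / M) = e n ^ 2 * (t / M) by ring, mul_assoc,
      Real.sqrt_mul (sq_nonneg _), Real.sqrt_sq (he0 n hn'), Real.sqrt_mul (by positivity)]
    calc 2 * (e n * (Real.sqrt (t / M) *
          Real.sqrt (x + ∑ k ∈ Finset.range (n + 1), Real.log (2 * N k))))
        ≤ 2 * (4 * (ε₀ / 2 ^ n) * (Real.sqrt (t / M) *
          (Real.sqrt x + ∑ k ∈ Finset.range (n + 1), l k))) := by
          gcongr
          exact he n hn'
      _ = _ := by ring
  refine (Finset.sum_le_sum hterm).trans ?_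
  rw [← Finset.mul_sum]
  have h2 := sum_dyadic_mul_sum ε₀ (Real.sqrt x) l (J + 1)
  have h3 : 0 ≤ 2 * (ε₀ / 2 ^ (J + 1)) * (Real.sqrt x + ∑ k ∈ Finset.range (J + 1), l k) := by
    have := Finset.sum_nonneg fun k (_ : k ∈ Finset.range (J + 1)) => hl0 k
    positivity
  have h4 : ∑ k ∈ Finset.range (J + 1), ε₀ / 2 ^ k * l k ≤ 4 * I := by
    calc _ = 4 * ∑ k ∈ Finset.range (J + 1), ε₀ / 2 ^ k / 2 * Real.sqrt (Real.log (1 + N k)) := by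
          rw [Finset.mul_sum]
          refine Finset.sum_congr rfl fun k _ => ?_
          simp only [hl]
          ring
      _ ≤ _ := by gcongr
  have h5 : ε₀ * Real.sqrt x ≤ B * Real.sqrt x := by gcongr
  calc _ ≤ 8 * Real.sqrt (t / M) * (2 * B * Real.sqrt x + 8 * I) := by
        gcongr
        linarith
    _ = _ := by ring

/-- The price `∑ log (2 N k)` pays for the number of increments and leaves one factor `1/2` per
level, which makes the levels summable. -/
theorem prod_mul_exp_neg_sum_log {N : ℕ → ℕ} {J n : ℕ} (hn : n ≤ J) (hN : ∀ k ≤ J, 1 ≤ N k)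
    (x : ℝ) : ((∏ k ∈ Finset.range (n + 1), N k : ℕ) : ℝ) *
      Real.exp (-(x + ∑ k ∈ Finset.range (n + 1), Real.log (2 * N k))) =
      Real.exp (-x) * (1 / 2) ^ (n + 1) := by
  have hpos : ∀ k ∈ Finset.range (n + 1), (0 : ℝ) < N k := fun k hk =>
    Nat.cast_pos.2 (hN k ((Nat.lt_succ_iff.1 (Finset.mem_range.1 hk)).trans hn))
  have h1 : Real.exp (-∑ k ∈ Finset.range (n + 1), Real.log (2 * N k)) =
      ∏ k ∈ Finset.range (n + 1), (2 * (N k : ℝ))⁻¹ := by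
    rw [← Finset.sum_neg_distrib, Real.exp_sum]
    refine Finset.prod_congr rfl fun k hk => ?_
    have := hpos k hk
    rw [Real.exp_neg, Real.exp_log (by positivity)]
  rw [neg_add, Real.exp_add, h1, mul_left_comm, Nat.cast_prod, ← Finset.prod_mul_distrib]
  congr 1
  rw [Finset.prod_congr rfl fun k hk => ?_, Finset.prod_const, Finset.card_range]
  have := hpos k hk
  field_simp

theorem sum_prod_mul_exp_le {N : ℕ → ℕ} {J : ℕ} (hN : ∀ k ≤ J, 1 ≤ N k) (x : ℝ) :
    ∑ n ∈ Finset.range (J + 1), ((∏ k ∈ Finset.range (n + 1), N k : ℕ) : ℝ≥0∞) *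
      ENNReal.ofReal
        (Real.exp (-(x + ∑ k ∈ Finset.range (n + 1), Real.log (2 * N k)))) ≤
      ENNReal.ofReal (Real.exp (-x)) := by
  calc _ = ∑ n ∈ Finset.range (J + 1),
        ENNReal.ofReal (Real.exp (-x) * (1 / 2) ^ (n + 1)) := by
        refine Finset.sum_congr rfl fun n hn => ?_
        rw [← ENNReal.ofReal_natCast, ← ENNReal.ofReal_mul (Nat.cast_nonneg _),
          prod_mul_exp_neg_sum_log (Nat.lt_succ_iff.1 (Finset.mem_range.1 hn)) hN]
    _ = ENNReal.ofReal (∑ n ∈ Finset.range (J + 1), Real.exp (-x) * (1 / 2) ^ (n + 1)) :=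
        (ENNReal.ofReal_sum_of_nonneg fun n _ => by positivity).symm
    _ ≤ _ := by
        refine ENNReal.ofReal_le_ofReal ?_
        have h : ∑ n ∈ Finset.range (J + 1), (1 / 2 : ℝ) ^ (n + 1) ≤ 1 := by
          simp_rw [pow_succ, ← Finset.sum_mul]
          have := sum_geometric_two_le (J + 1)
          linarith
        rw [← Finset.mul_sum]
        exact mul_le_of_le_one_right (Real.exp_pos _).le h

/-! ### The mappings `φ` and differences of risks -/

theorem monotone_phiId : Monotone phiId := monotone_id

theorem lipschitzWith_phiId : LipschitzWith 1 phiId := LipschitzWith.id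

theorem monotone_phiHinge : Monotone phiHinge := fun a b h => by
  unfold phiHinge; gcongr

theorem lipschitzWith_phiHinge : LipschitzWith 1 phiHinge := by
  refine LipschitzWith.of_dist_le_mul fun a b => ?_
  rw [Real.dist_eq, Real.dist_eq, NNReal.coe_one, one_mul]
  refine (abs_max_sub_max_le_max 0 (1 + a) 0 (1 + b)).trans_eq ?_
  simp

theorem measurable_of_forall_measurable_section {K d : ℕ} {f : Fin K × Ctx d → ℝ}
    (hf : ∀ a, Measurable fun w => f (a, w)) : Measurable f :=
  measurable_from_prod_countable_right hf

/-- The difference `h - h₀` is bounded, so the two losses are integrable together or not at all. In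
the latter case both Bochner integrals take the default value `0`. -/
theorem risk_id_sub_eq_or {K d : ℕ} [NeZero K] {Q : Measure (Ctx d)} [IsProbabilityMeasure Q]
    {κ : Kernel (Fin K × Ctx d) (Fin 2)} [IsMarkovKernel κ] {h h₀ : Fin K × Ctx d → ℝ}
    (hh : Measurable h) (hh₀ : Measurable h₀) {B : ℝ} (hB : ∀ p, |h p - h₀ p| ≤ B) :
    risk Q κ id h - risk Q κ id h₀ = risk Q κ id (h - h₀) ∨
      risk Q κ id h - risk Q κ id h₀ = 0 := by
  have hd := integrable_loss_id Q κ (hh.sub hh₀) hB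
  have hadd : (fun o : (Fin K × Ctx d) × Fin 2 => loss id h o.1.2 o.1.1 o.2) =
      (fun o => loss id (h - h₀) o.1.2 o.1.1 o.2) + fun o => loss id h₀ o.1.2 o.1.1 o.2 := by
    funext o
    rw [Pi.add_apply, ← loss_id_add, sub_add_cancel]
  by_cases hi : Integrable (fun o : (Fin K × Ctx d) × Fin 2 => loss id h₀ o.1.2 o.1.1 o.2)
      (refLaw Q κ)
  · left
    unfold risk
    rw [hadd, integral_add' hd hi, add_sub_cancel_right]
  · right
    have hi' : ¬Integrable (fun o : (Fin K × Ctx d) × Fin 2 => loss id h o.1.2 o.1.1 o.2)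
        (refLaw Q κ) := by
      rwa [hadd, integrable_add_iff_integrable_right hd]
    unfold risk
    rw [integral_undef hi, integral_undef hi', sub_zero]

theorem sum_weightedValue_sub {Ω : Type*} {K d t : ℕ} (ht : 1 ≤ t)
    {g : ℕ → Ω → Fin K × Ctx d → ℝ} {W : ℕ → Ω → Ctx d} {A : ℕ → Ω → Fin K}
    {Y : ℕ → Ω → Fin 2} (φ : ℝ → ℝ) (f f₀ : Fin K × Ctx d → ℝ) (ω : Ω) :
    ∑ τ ∈ Finset.Icc 1 t, weightedValue g W A Y (φ ∘ f - φ ∘ f₀) τ ω =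
      t * (empiricalRisk t φ (fun τ => g τ ω) (fun τ => W τ ω) (fun τ => A τ ω)
          (fun τ => Y τ ω) f -
        empiricalRisk t φ (fun τ => g τ ω) (fun τ => W τ ω) (fun τ => A τ ω)
          (fun τ => Y τ ω) f₀) := by
  have ht' : (t : ℝ) ≠ 0 := by exact_mod_cast (Nat.one_le_iff_ne_zero.1 ht)
  unfold empiricalRisk
  rw [← mul_sub, mul_inv_cancel_left₀ ht', ← Finset.sum_sub_distrib]
  refine Finset.sum_congr rfl fun τ _ => ?_
  simp only [weightedValue, isLoss, loss, Pi.sub_apply, Function.comp_apply, id]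
  ring

/-- As `K ≥ 1`, `√(t / (Kδ)) ≤ t √(K / (δt))`. The coefficients `16 + 2 = 18` of `B √x` and `64` of
`I` are then both below `160`. -/
theorem deviation_rate_le {K t : ℕ} (hK : 1 ≤ K) (ht : 1 ≤ t) {δ B x I α : ℝ} (hδ : 0 < δ)
    (hB : 0 < B) (hx : 0 < x) (hI : 0 ≤ I) :
    t * α + Real.sqrt (t / (K * δ)) * (16 * B * Real.sqrt x + 64 * I) +
        (2 * Real.sqrt (t * (B ^ 2 / (K * δ)) * x) + B * x / (K * δ)) ≤
      t * (α + 160 * Real.sqrt (K / δ / t) * I +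
        (160 * B * Real.sqrt (K * x / (δ * t)) + 3 * B * x / (δ * t))) := by
  have hK' : (1 : ℝ) ≤ K := by exact_mod_cast hK
  have ht' : (1 : ℝ) ≤ t := by exact_mod_cast ht
  have ht0 : (0 : ℝ) < t := by linarith
  have hK0 : (0 : ℝ) < K := by linarith
  set ρ := Real.sqrt (K / δ / t) with hρ
  have hρ0 : 0 ≤ ρ := Real.sqrt_nonneg _
  have h1 : Real.sqrt (t / (K * δ)) ≤ t * ρ := by
    refine Real.sqrt_le_iff.2 ⟨by positivity, ?_⟩
    rw [mul_pow, hρ, Real.sq_sqrt (by positivity), div_le_iff₀ (by positivity)]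
    have : (t : ℝ) ^ 2 * (K / δ / t) * (K * δ) = t * K ^ 2 := by field_simp
    rw [this]
    exact le_mul_of_one_le_right ht0.le (one_le_pow₀ hK')
  have h2 : Real.sqrt (t * (B ^ 2 / (K * δ)) * x) =
      Real.sqrt (t / (K * δ)) * (B * Real.sqrt x) := by
    rw [show t * (B ^ 2 / (K * δ)) * x = t / (K * δ) * (B ^ 2 * x) by ring,
      Real.sqrt_mul (by positivity), Real.sqrt_mul (sq_nonneg B), Real.sqrt_sq hB.le]
  have h3 : Real.sqrt (K * x / (δ * t)) = ρ * Real.sqrt x := by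
    rw [hρ, ← Real.sqrt_mul (by positivity)]
    congr 1
    field_simp
  have h4 : B * x / (K * δ) ≤ t * (3 * B * x / (δ * t)) := by
    have : t * (3 * B * x / (δ * t)) = 3 * (B * x) / δ := by field_simp
    rw [this, div_le_div_iff₀ (by positivity) hδ]
    have : 0 < B * x * δ := by positivity
    nlinarith
  rw [h2, h3]
  have h5 : 0 ≤ B * Real.sqrt x := by positivity
  have h6 := mul_le_mul_of_nonneg_right h1 (show 0 ≤ 18 * (B * Real.sqrt x) + 64 * I by positivity)
  have h7 : 0 ≤ t * ρ * (142 * (B * Real.sqrt x) + 96 * I) := by positivity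
  linarith

/-! ### The excess risk bound -/

theorem IsContextualBandit.excess_risk_bound {Ω : Type*} [MeasurableSpace Ω] {K d : ℕ}
    {μ : Measure Ω} {Q : Measure (Ctx d)} {κ : Kernel (Fin K × Ctx d) (Fin 2)} {t : ℕ}
    {g : ℕ → Ω → Fin K × Ctx d → ℝ} {W : ℕ → Ω → Ctx d} {A : ℕ → Ω → Fin K}
    {Y : ℕ → Ω → Fin 2} [IsProbabilityMeasure μ]
    [IsProbabilityMeasure Q] [IsMarkovKernel κ] [NeZero K]
    (hb : IsContextualBandit μ Q κ t g W A Y) (ht : 1 ≤ t)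
    (hg0 : ∀ τ ∈ Finset.Icc 1 t, ∀ ω, IsPolicy (g τ ω))
    (hg : ∀ τ ∈ Finset.Icc 1 t, IsMeasurableDesign (history W A Y (τ - 1)) (g τ))
    {φ : ℝ → ℝ} (hφ : Monotone φ) (hφL : LipschitzWith 1 φ)
    {F : Set (Fin K × Ctx d → ℝ)} (hFm : ∀ f ∈ F, Measurable f)
    {B δ : ℝ} (hB : 0 < B) (hδ : 0 < δ)
    (hosc : ∀ f₁ ∈ F, ∀ f₂ ∈ F, ∀ a w, |φ (f₁ (a, w)) - φ (f₂ (a, w))| ≤ B)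
    (hlower : ∀ τ ∈ Finset.Icc 1 t, ∀ᵐ ω ∂μ, ∀ a, δ ≤ g τ ω (a, W τ ω))
    {f₀ : Fin K × Ctx d → ℝ} (hf₀ : f₀ ∈ F) {fhat : Ω → Fin K × Ctx d → ℝ}
    (hfhat : ∀ᵐ ω ∂μ, fhat ω ∈ F ∧ ∀ f ∈ F,
      empiricalRisk t φ (fun τ => g τ ω) (fun τ => W τ ω) (fun τ => A τ ω)
          (fun τ => Y τ ω) (fhat ω)
        ≤ empiricalRisk t φ (fun τ => g τ ω) (fun τ => W τ ω) (fun τ => A τ ω)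
          (fun τ => Y τ ω) f)
    {x α : ℝ} (hx : 0 < x) (hα : α ∈ Set.Ioo 0 B) :
    μ {ω | entropyBound (fun ε => bracketingNumber ε F 2 (refDesignLaw Q)) t α δ (K / δ) B
          + ENNReal.ofReal (160 * B * Real.sqrt (K * x / (δ * t)) + 3 * B * x / (δ * t))
        ≤ ENNReal.ofReal (risk Q κ φ (fhat ω) - risk Q κ φ f₀)}
      ≤ ENNReal.ofReal (2 * Real.exp (-x)) := by
  classical
  obtain ⟨hα0, hαB⟩ := hα
  have hK1 : 1 ≤ K := NeZero.one_le
  have hK0 : (0 : ℝ) < K := Nat.cast_pos.2 hK1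
  have ht0 : (0 : ℝ) < t := Nat.cast_pos.2 ht
  set ψ : ℝ → ℝ≥0∞ := fun ε => sqrtLogOneAdd (bracketingNumber ε F 2 (refDesignLaw Q)) with hψ
  have hψanti : Antitone ψ :=
    sqrtLogOneAdd_mono.comp_antitone (bracketingNumber_antitone F 2 _)
  -- If the entropy integral diverges the threshold is `⊤`, which no `ENNReal.ofReal` reaches, so
  -- the event is empty.
  by_cases hint : ∫⁻ ε in Set.Icc (α / 2) B, ψ ε = ⊤
  · have htop : entropyBound (fun ε => bracketingNumber ε F 2 (refDesignLaw Q)) t α δ (K / δ) B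
        = ⊤ := by
      unfold entropyBound
      rw [show ∫⁻ ε in Set.Icc (α / 2) B,
        sqrtLogOneAdd (bracketingNumber ε F 2 (refDesignLaw Q)) = ⊤ from hint,
        ENNReal.mul_top (by
          rw [Ne, ENNReal.ofReal_eq_zero, not_le]
          positivity)]
      simp
    simp [htop]
  set I := (∫⁻ ε in Set.Icc (α / 2) B, ψ ε).toReal with hIdef
  have hI0 : 0 ≤ I := ENNReal.toReal_nonneg
  -- `J` is chosen so that `ε₀ = 2^J α` satisfies `ε₀ ≤ B < 2 ε₀`: the scales end exactly at `α`,
  -- and the initial `2B` is at most `4 ε₀`.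
  obtain ⟨J, hJ1, hJ2⟩ := exists_nat_pow_near (one_le_div hα0 |>.2 hαB.le) one_lt_two
  rw [le_div_iff₀ hα0] at hJ1
  rw [div_lt_iff₀ hα0, pow_succ] at hJ2
  set ε₀ := 2 ^ J * α with hε₀
  have hε₀0 : 0 < ε₀ := by positivity
  set ε : ℕ → ℝ := fun n => ε₀ / 2 ^ n with hε
  have hεJ : ε J = α := by simp only [hε, hε₀]; field_simp
  have hεpos : ∀ n, 0 < ε n := fun n => by simp only [hε]; positivity
  have hsum : ∑ k ∈ Finset.range (J + 1), ENNReal.ofReal (ε k / 2) * ψ (ε k) ≤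
      ∫⁻ ε in Set.Icc (α / 2) B, ψ ε := by
    have := sum_dyadic_le_lintegral hψanti hε₀0.le hJ1 J
    rwa [show ε₀ / 2 ^ J = α from hεJ] at this
  -- A finite integral dominates each dyadic term, so every bracketing number in use is finite.
  have hfin : ∀ n ≤ J, bracketingNumber (ε n) F 2 (refDesignLaw Q) ≠ ⊤ := by
    intro n hn htop
    have h1 := (Finset.single_le_sum (f := fun k => ENNReal.ofReal (ε k / 2) * ψ (ε k))
      (fun _ _ => zero_le) (Finset.mem_range.2 (Nat.lt_succ_of_le hn))).trans hsum
    have h2 : ψ (ε n) = ⊤ := by simp [hψ, htop, sqrtLogOneAdd]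
    rw [h2, ENNReal.mul_top (by simpa using half_pos (hεpos n)), top_le_iff] at h1
    exact hint h1
  have hex : ∀ n, ∃ S, n ≤ J → IsBracketing (ε n) F 2 (refDesignLaw Q) S ∧
      (S.card : ℕ∞) = bracketingNumber (ε n) F 2 (refDesignLaw Q) := fun n => by
    by_cases hn : n ≤ J
    · obtain ⟨S, hS⟩ := exists_isBracketing_of_bracketingNumber_ne_top (hfin n hn)
      exact ⟨S, fun _ => hS⟩
    · exact ⟨∅, fun h => absurd h hn⟩
  choose S hS using hex
  have hScard : ∀ n ≤ J, 1 ≤ (S n).card := fun n hn => by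
    obtain ⟨b, hb, -⟩ := (hS n hn).1.2 f₀ hf₀
    exact Finset.card_pos.2 ⟨b, hb⟩
  have hIsum : ∑ k ∈ Finset.range (J + 1),
      ε₀ / 2 ^ k / 2 * Real.sqrt (Real.log (1 + (S k).card)) ≤ I := by
    rw [hIdef, ← ENNReal.ofReal_le_iff_le_toReal hint,
      ENNReal.ofReal_sum_of_nonneg fun k _ => by positivity]
    refine le_trans (Finset.sum_le_sum fun k hk => ?_) hsum
    have hkJ : k ≤ J := Nat.lt_succ_iff.1 (Finset.mem_range.1 hk)
    rw [ENNReal.ofReal_mul (by positivity)]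
    simp only [hψ, ← (hS k hkJ).2, sqrtLogOneAdd, ENat.natCast_ne_top, if_false, ENat.toNat_natCast]
    exact le_rfl
  set e : ℕ → ℝ := fun n => if n = 0 then 2 * B else ε (n - 1) with he
  have hεsucc : ∀ n, ε n = 2 * ε (n + 1) := fun n => by
    simp only [hε, pow_succ]
    field_simp
  have he0 : ∀ n ≤ J, 0 ≤ e n := fun n _ => by
    simp only [he]
    split_ifs
    · positivity
    · exact (hεpos _).le
  have he4 : ∀ n ≤ J, e n ≤ 4 * (ε₀ / 2 ^ n) := by
    rintro (_ | n) _
    · simp only [he, if_true, pow_zero, div_one]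
      linarith
    · simp only [he, Nat.add_eq_zero_iff, one_ne_zero, and_false, if_false,
        Nat.add_sub_cancel]
      have h1 := hεsucc n
      have h2 := hεpos (n + 1)
      change ε n ≤ 4 * ε (n + 1)
      linarith
  have hy : ∀ n ≤ J, 0 ≤ x + ∑ k ∈ Finset.range (n + 1), Real.log (2 * (S k).card) := by
    intro n hn
    refine add_nonneg hx.le (Finset.sum_nonneg fun k hk => Real.log_nonneg ?_)
    have : (1 : ℝ) ≤ (S k).card := by
      exact_mod_cast hScard k ((Nat.lt_succ_iff.1 (Finset.mem_range.1 hk)).trans hn)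
    linarith
  obtain ⟨N, hN, hgood⟩ := hb.exists_deviation_bound ht hg0 hg hδ hlower
    (H := (fun f => φ ∘ f) '' F)
    (by rintro _ ⟨f, hf, rfl⟩; exact hφ.measurable.comp (hFm f hf))
    ⟨f₀, hf₀, rfl⟩ hB
    (by rintro _ ⟨f, hf, rfl⟩ ⟨a, w⟩; exact hosc f hf f₀ hf₀ a w)
    (J := J) (e := e) (y := fun n => x + ∑ k ∈ Finset.range (n + 1), Real.log (2 * (S k).card))
    (fun n hn => (hS n hn).1.comp hφ hφL) (by simp [he]) (fun n _ => by simp [he])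
    (fun n _ => hεpos n) hy hx
  have hμN : μ N ≤ ENNReal.ofReal (2 * Real.exp (-x)) := by
    refine hN.trans ?_
    rw [two_mul, ENNReal.ofReal_add (Real.exp_pos _).le (Real.exp_pos _).le]
    refine add_le_add le_rfl (le_trans (Finset.sum_le_sum fun n _ => ?_)
      (sum_prod_mul_exp_le hScard x))
    exact mul_le_mul' (Nat.cast_le.2 (Finset.prod_le_prod' fun k _ => Finset.card_image_le)) le_rfl
  -- Only monotonicity of `μ` on arbitrary sets is used, so no measurability of `fhat` is needed.
  refine le_trans (measure_mono_ae ?_) hμN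
  filter_upwards [hfhat] with ω hω hev
  by_contra hωN
  obtain ⟨hωF, hωmin⟩ := hω
  have hdev := hgood ω hωN _ ⟨fhat ω, hωF, rfl⟩
  change entropyBound _ t α δ (K / δ) B + _ ≤ _ at hev
  have hlow : ENNReal.ofReal (α + 160 * Real.sqrt (K / δ / t) * I +
      (160 * B * Real.sqrt (K * x / (δ * t)) + 3 * B * x / (δ * t))) ≤
      ENNReal.ofReal (risk Q κ φ (fhat ω) - risk Q κ φ f₀) := by
    refine le_trans ?_ hev
    rw [ENNReal.ofReal_add (by positivity) (by positivity),
      ENNReal.ofReal_add hα0.le (by positivity), ENNReal.ofReal_mul (by positivity), hIdef,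
      ENNReal.ofReal_toReal hint]
    unfold entropyBound
    -- The `log 2` term of the entropy bound is nonnegative and is discarded.
    exact add_le_add le_self_add le_rfl
  -- Positivity matters twice: it excludes truncation at `0` in `ENNReal.ofReal`, and it excludes
  -- the non-integrable case, where the difference of risks is `0`.
  have hposbound : 0 < α + 160 * Real.sqrt (K / δ / t) * I +
      (160 * B * Real.sqrt (K * x / (δ * t)) + 3 * B * x / (δ * t)) := by positivity
  have hR : α + 160 * Real.sqrt (K / δ / t) * I +
      (160 * B * Real.sqrt (K * x / (δ * t)) + 3 * B * x / (δ * t)) ≤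
      risk Q κ φ (fhat ω) - risk Q κ φ f₀ := by
    rcases ENNReal.ofReal_le_ofReal_iff'.1 hlow with h | h
    · exact h
    · exact absurd h (not_le.2 hposbound)
  have hrisk : risk Q κ φ (fhat ω) - risk Q κ φ f₀ =
      risk Q κ id (φ ∘ fhat ω - φ ∘ f₀) := by
    rcases risk_id_sub_eq_or (Q := Q) (κ := κ) (hφ.measurable.comp (hFm _ hωF))
      (hφ.measurable.comp (hFm _ hf₀)) (B := B) (fun p => hosc _ hωF _ hf₀ p.1 p.2) with h | h
    · exact h
    · exact absurd (hR.trans_eq h) (not_le.2 hposbound)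
  -- `D` equals `t` times the excess risk minus `t` times the empirical excess, and the latter is
  -- nonpositive by minimality of `fhat`.
  have hdevrisk : t * (risk Q κ φ (fhat ω) - risk Q κ φ f₀) ≤
      deviation Q κ t g W A Y (φ ∘ fhat ω - φ ∘ f₀) ω := by
    rw [deviation, Finset.sum_sub_distrib, sum_weightedValue_sub ht, hrisk, Finset.sum_const,
      Nat.card_Icc, nsmul_eq_mul, Nat.add_sub_cancel]
    have := mul_nonneg ht0.le (sub_nonneg.2 (hωmin f₀ hf₀))
    linarith
  have hch := chaining_sum_le ht0 (mul_pos hK0 hδ) hx.le hε₀0.le hJ1 hScard he0 he4 hIsum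
  have hrate := deviation_rate_le (α := α) hK1 ht hδ hB hx hI0
  have hfinal := mul_le_mul_of_nonneg_left hR ht0.le
  rw [hεJ] at hdev
  linarith

end EpsGreedy

theorem mainTheorem4 {Ω : Type*} [MeasurableSpace Ω] (μ : Measure Ω) [IsProbabilityMeasure μ]
    (K d t : ℕ) (hK : 2 ≤ K) (ht : 1 ≤ t)
    -- law of the contexts, conditional law of the rewards
    (Q : Measure (EpsGreedy.Ctx d)) [IsProbabilityMeasure Q]
    (κ : Kernel (Fin K × EpsGreedy.Ctx d) (Fin 2)) [IsMarkovKernel κ]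
    -- the data and the designs
    (g : ℕ → Ω → Fin K × EpsGreedy.Ctx d → ℝ)
    (W : ℕ → Ω → EpsGreedy.Ctx d) (A : ℕ → Ω → Fin K) (Y : ℕ → Ω → Fin 2)
    (hbandit : EpsGreedy.IsContextualBandit μ Q κ t g W A Y)
    (hpolicy : ∀ τ ∈ Finset.Icc 1 t, ∀ ω, EpsGreedy.IsPolicy (g τ ω))
    (hpredictable : ∀ τ ∈ Finset.Icc 1 t,
      EpsGreedy.IsMeasurableDesign (EpsGreedy.history W A Y (τ - 1)) (g τ))
    -- the mapping `φ` and the matching regressor class `F`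
    (F₀ : Set (EpsGreedy.Ctx d → ℝ)) (hF₀ : ∀ h ∈ F₀, Measurable h)
    (φ : ℝ → ℝ) (F : Set (Fin K × EpsGreedy.Ctx d → ℝ))
    (hφF : (φ = EpsGreedy.phiId ∧ F = EpsGreedy.classId F₀) ∨
      (φ = EpsGreedy.phiHinge ∧ F = EpsGreedy.classHinge F₀))
    (B δ : ℝ) (hB : 0 < B) (hδ : 0 < δ)
    (hosc : ∀ f₁ ∈ F, ∀ f₂ ∈ F, ∀ a w, |φ (f₁ (a, w)) - φ (f₂ (a, w))| ≤ B)
    (hlower : ∀ τ ∈ Finset.Icc 1 t, ∀ᵐ ω ∂μ, ∀ a, δ ≤ g τ ω (a, W τ ω))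
    -- a minimizer of the `φ`-risk over `F`
    (fstar : Fin K × EpsGreedy.Ctx d → ℝ) (hfstar_mem : fstar ∈ F)
    (hfstar_min : ∀ f ∈ F, EpsGreedy.risk Q κ φ fstar ≤ EpsGreedy.risk Q κ φ f)
    -- a minimizer of the empirical `φ`-risk over `F`
    (fhat : Ω → Fin K × EpsGreedy.Ctx d → ℝ)
    (hfhat : ∀ᵐ ω ∂μ, fhat ω ∈ F ∧ ∀ f ∈ F,
      EpsGreedy.empiricalRisk t φ (fun τ => g τ ω) (fun τ => W τ ω) (fun τ => A τ ω)
          (fun τ => Y τ ω) (fhat ω)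
        ≤ EpsGreedy.empiricalRisk t φ (fun τ => g τ ω) (fun τ => W τ ω) (fun τ => A τ ω)
          (fun τ => Y τ ω) f)
    (x α : ℝ) (hx : 0 < x) (hα : α ∈ Set.Ioo 0 B) :
    μ {ω |
        EpsGreedy.entropyBound
            (fun ε => EpsGreedy.bracketingNumber ε F 2 (EpsGreedy.refDesignLaw Q))
            t α δ (K / δ) B
          + ENNReal.ofReal (160 * B * Real.sqrt (K * x / (δ * t)) + 3 * B * x / (δ * t))
        ≤ ENNReal.ofReal (EpsGreedy.risk Q κ φ (fhat ω) - EpsGreedy.risk Q κ φ fstar)}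
      ≤ ENNReal.ofReal (2 * Real.exp (-x)) := by
  have : NeZero K := ⟨by omega⟩
  have hFm : ∀ f ∈ F, Measurable f := by
    intro f hf
    refine EpsGreedy.measurable_of_forall_measurable_section fun a => hF₀ _ ?_
    rcases hφF with ⟨-, rfl⟩ | ⟨-, rfl⟩ <;> exact hf.1 a
  have hφ : Monotone φ ∧ LipschitzWith 1 φ := by
    rcases hφF with ⟨rfl, -⟩ | ⟨rfl, -⟩
    · exact ⟨EpsGreedy.monotone_phiId, EpsGreedy.lipschitzWith_phiId⟩
    · exact ⟨EpsGreedy.monotone_phiHinge, EpsGreedy.lipschitzWith_phiHinge⟩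
  exact hbandit.excess_risk_bound ht hpolicy hpredictable hφ.1 hφ.2 hFm hB hδ hosc hlower
    hfstar_mem hfhat hx hα
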